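/- **Setting.** Let $\Bbbk$ be a field, $\mathsf C$ a small category and $\mathcal A$ a functor from $\mathsf C$ to the category of associative (not necessarily unital) $\Bbbk$-algebras. Put $$C^{p,q}=\prod_{x_0\leftarrow\cdots\leftarrow x_p}\mathrm{Hom}_\Bbbk(\mathcal A(x_p)^{\otimes q},\mathcal A(x_0)),\qquad C=\bigoplus_{p,q\ge0}C^{p,q},$$ the product being over the $p$-simplices $\phi=(\phi_1,\dots,\phi_p)$, $\phi_i:x_i\to x_{i-1}$, of the nerve of $\mathsf C$. An element of $C^{p,q}$ has shifted total degree $p+q-1$. The asimplicial subcomplex is $C_{\mathrm a}=\bigoplus_{p\ge0,\,q\ge1}C^{p,q}$. Let $\hat{\mathsf m}\in C^{0,2}$ be the multiplication. **Quilts.** A quilt $Q$ of arity $n$ and degree $d$ consists of - a word $W$ of length $n+d$ over $\{1,\dots,n\}$ in which every letter occurs, without equal consecutive letters and without interlacing $u\dots v\dots u\dots v$ ($u\ne v$), and - a planar rooted tree $T$ with vertex set $\{1,\dots,n\}$ (write $u\le v$ if $u$ is an ancestor of $v$ or $u=v$, and $u\lhd v$ if $u$ is to the left of $v$, which is only defined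 for $\le$-incomparable vertices), such that $W=\dots u\dots v\dots$ implies $u\not> v$, and $W=\dots u\dots v\dots u\dots$ with $v\neq u$ implies $v\lhd u$. A vertex $v$ is interposed if $W=\dots uv\dots u\dots$ for some $u$. We say that $Q$ is labelled in $\downarrow$ order if the first occurrences of $1,\dots,n$ in $W$ come in this order. **Colorings.** Let $f_a\in C^{p_a,q_a}$ ($1\le a\le n$), $p'=\sum_a p_a-d$, $q'=1+\sum_a(q_a-1)$. A coloring of $Q$ consists of - strictly increasing maps $\zeta_a:\{0,\dots,p_a\}\to\{0,\dots,p'\}$ whose images cover $\{0,\dots,p'\}$, such that there are maps $\pi_a$ from $\{0,\dots,p_a\}$ onto the set of occurrences of $a$ in $W$ (these are then unique) for which the sets $\zeta_a(\pi_a^{-1}(\underline a))$ are intervals, and for consecutive letters $\underline a\,\underline b$ of $W$ the maximum of the interval of $\underline a$ is the minimum of the interval of $\underline b$; - a number $I_{(a,b)}\in\{1,\dots,q_a\}$ for each edge from a vertex $a$ to a child $b$, strictly increasing from left to right over the children of $a$. Given a coloring, $\mathcal L(\zeta,I;f_1,\dots,f_n)\in C^{p',q'}$ is the cochain whose value at $\phi$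 is obtained by composing the maps $f_a[\zeta_a^*\phi]$ along $T$: $f_b$ is inserted in the $I_{(a,b)}$-th input of $f_a$ for each edge $(a,b)$, and $\mathcal A$ of the appropriate compositions of the $\phi_i$ is applied between the maps, after the root, and at the free inputs. **Signs.** Associate to $a$ the vertical letters $0,\dots,p_a-1$ followed by the horizontal letters $1,\dots,q_a-1$. The sign $\mathrm{sgn}_Q(\zeta,I)$ is that of the permutation which takes the concatenation of these sequences for $a=1,\dots,n$ to the sequence consisting of: the vertical letters $0$ of the interposed vertices, in reverse order of first occurrence in $W$; then the other vertical letters, the letter $i$ of $a$ being in position $\zeta_a(i)$; then the horizontal letters, in the order in which one passes them going around $T$ from the left, where the letters $1,\dots,I_{(a,b)}-1$ of $a$, and no later letter of $a$, precede those of the descendants of $b$ (and $b$ itself). If $q_a=0$, it is replaced with $2$ for this purpose; if $a$ is interposed and $p_a=0$, the interval of $a$ is first lengthened by $2$, what comes later in the word being shifted by $2$. **Operations.** Let $\widehat Q(f_1,\dots,f_n)=\sum_{(\zeta,I)}\mathrm{sgn}_Q(\zeta,I)\,\mathcal L(\zeta,I;f_1,\dots,f_n)$, extended multilinearly to $C$.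 Let $\delta=\delta^{\mathrm S}+\delta^{\mathrm H}$, where $\delta^{\mathrm S}=\sum_{i=0}^{p+1}(-1)^i\delta^{\mathrm S}_i$ on $C^{p,q}$ is the simplicial coboundary ($\delta_i^{\mathrm S}f$ at $\phi$ is $f$ at the simplex with $x_i$ omitted, composed with $\mathcal A[\phi_1]$ after it if $i=0$, and with $\mathcal A[\phi_{p+1}]$ at all inputs if $i=p+1$), and $\delta^{\mathrm H}f=\widehat{Q_{12}}(\hat{\mathsf m},f)-\widehat{Q_{21}}(\hat{\mathsf m},f)$, where $Q_{12}$ has the word $12$ and root $1$, and $Q_{21}$ the word $21$ and root $2$. For $n\ge2$ let $P_n^0$ be $(-1)^{1+n(n-1)/2}$ times the sum of all quilts of arity $n$ and degree $n-2$ labelled in $\downarrow$ order, and let $$\widehat{P_n}(f_1,\dots,f_n)=\widehat{P_n^0}(f_1,\dots,f_n)+\widehat{P^0_{n+1}}(\hat{\mathsf m},f_1,\dots,f_n).$$ The Maurer–Cartan equation for $f\in C$ of shifted total degree $1$ (that is, $f\in C^{0,2}\oplus C^{1,1}\oplus C^{2,0}$) is $$0=\delta f+\sum_{n=2}^\infty\widehat{P_n}(f,\dots,f),$$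 which includes that only finitely many terms of the sum are nonzero. **Proposition.** Let $f\in C$ have shifted total degree $1$. 1. If $f\in C_{\mathrm a}$, then $\widehat{P_n}(f,\dots,f)=0$ for all $n\ge4$, and the Maurer–Cartan equation is equivalent to the cubic equation $$0=\delta f+\widehat{P_2}(f,f)+\widehat{P_3}(f,f,f).$$ 2. In general, $\widehat{P_n}(f,\dots,f)=0$ for all $n\ge5$, and the Maurer–Cartan equation is equivalent to the quartic equation $$0=\delta f+\widehat{P_2}(f,f)+\widehat{P_3}(f,f,f)+\widehat{P_4}(f,f,f,f).$$ 3. $\widehat{P_4}(f,f,f,f)=-\widehat Q(f,f,f,f)$, where $Q$ is the quilt with the word $123242$ and the tree with the edges $1\to3$, $1\to2$, $3\to4$, the vertices $3$ and $4$ being to the left of $2$. -/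

import Mathlib

open CategoryTheory Opposite

universe u v w t

namespace HochschildQuilt

/-! ## Planar rooted trees -/

/-- A planar rooted tree with vertex set `{0, …, n-1}`: edges `(parent, child)`, a strict
left-to-right relation `left`, and the ancestor order generated by the edges. -/
structure PTree (n : ℕ) where
  edge : Fin n → Fin n → Bool
  left : Fin n → Fin n → Bool
  edge_irrefl : ∀ u, ¬ edge u u
  le_antisymm' : ∀ u v, Relation.ReflTransGen (fun a b => edge a b) u v →
    Relation.ReflTransGen (fun a b => edge a b) v u → u = v
  root_unique : ∃! r, ∀ u, Relation.ReflTransGen (fun a b => edge a b) u r → u = r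
  edge_minimal : ∀ u v, edge u v → ¬ ∃ t, (t ≠ u ∧ t ≠ v) ∧
    Relation.ReflTransGen (fun a b => edge a b) u t ∧
    Relation.ReflTransGen (fun a b => edge a b) t v
  left_irrefl : ∀ u, ¬ left u u
  left_trans : ∀ u v w, left u v → left v w → left u w
  comparability : ∀ u v, (left u v ∨ left v u) ↔
    ¬ (Relation.ReflTransGen (fun a b => edge a b) u v ∨
       Relation.ReflTransGen (fun a b => edge a b) v u)
  inheritance : ∀ u v u' v', left u v →
    Relation.ReflTransGen (fun a b => edge a b) u u' →
    Relation.ReflTransGen (fun a b => edge a b) v v' → left u' v'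

namespace PTree

variable {n : ℕ} (T : PTree n)

/-- `T.le u v`: `u` is an ancestor of `v`, or `u = v`. -/
def le (u v : Fin n) : Prop := Relation.ReflTransGen (fun a b => T.edge a b) u v

/-- The type of edges of `T`. -/
abbrev Edge : Type := {e : Fin n × Fin n // T.edge e.1 e.2}

theorem le_refl (u : Fin n) : T.le u u := Relation.ReflTransGen.refl

theorem le_trans {u v w : Fin n} (h : T.le u v) (h' : T.le v w) : T.le u w :=
  Relation.ReflTransGen.trans h h'

theorem le_of_edge {u v : Fin n} (h : T.edge u v) : T.le u v := Relation.ReflTransGen.single h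

theorem le_antisymm {u v : Fin n} (h : T.le u v) (h' : T.le v u) : u = v :=
  T.le_antisymm' u v h h'

theorem ne_of_edge {u v : Fin n} (h : T.edge u v) : u ≠ v := by
  rintro rfl; exact T.edge_irrefl _ h

/-- The root of `T`. -/
noncomputable def root : Fin n := T.root_unique.choose

theorem root_spec (u : Fin n) (h : T.le u T.root) : u = T.root :=
  T.root_unique.choose_spec.1 u h

open Classical in
/-- The number of descendants of a vertex (used only for termination). -/
noncomputable def size (u : Fin n) : ℕ := (Finset.univ.filter (fun v => T.le u v)).card

theorem size_lt_of_lt {u v : Fin n} (h : T.le u v) (hne : u ≠ v) : T.size v < T.size u := by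
  classical
  apply Finset.card_lt_card
  rw [Finset.ssubset_iff_of_subset]
  · refine ⟨u, by simp [T.le_refl], ?_⟩
    simp only [Finset.mem_filter, Finset.mem_univ, true_and]
    exact fun h' => hne (T.le_antisymm h h')
  · intro w
    simp only [Finset.mem_filter, Finset.mem_univ, true_and]
    exact T.le_trans h

theorem size_lt {u v : Fin n} (h : T.edge u v) : T.size v < T.size u :=
  T.size_lt_of_lt (T.le_of_edge h) (T.ne_of_edge h)

theorem root_le (v : Fin n) : T.le T.root v := by
  classical
  have key : ∀ k (v : Fin n), n - T.size v ≤ k → ∃ r, T.le r v ∧ ∀ u, T.le u r → u = r := by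
    intro k
    induction k with
    | zero =>
      intro v hv
      refine ⟨v, T.le_refl v, fun u hu => ?_⟩
      by_contra hne
      have h1 := T.size_lt_of_lt hu hne
      have h2 : T.size u ≤ n := by
        simpa [size] using Finset.card_le_univ (Finset.univ.filter (fun w => T.le u w))
      omega
    | succ k ih =>
      intro v hv
      by_cases hm : ∀ u, T.le u v → u = v
      · exact ⟨v, T.le_refl v, hm⟩
      · push Not at hm
        obtain ⟨u, hu, hne⟩ := hm
        have h1 := T.size_lt_of_lt hu hne
        have h2 : T.size u ≤ n := by
          simpa [size] using Finset.card_le_univ (Finset.univ.filter (fun w => T.le u w))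
        obtain ⟨r, hr, hmin⟩ := ih u (by omega)
        exact ⟨r, T.le_trans hr hu, hmin⟩
  obtain ⟨r, hr, hmin⟩ := key _ v le_rfl
  have : r = T.root := T.root_unique.choose_spec.2 r hmin
  exact this ▸ hr

theorem not_edge_root (u : Fin n) : ¬ T.edge u T.root := fun h =>
  T.ne_of_edge h (T.root_spec u (T.le_of_edge h))

theorem parent_unique {u w v : Fin n} (hu : T.edge u v) (hw : T.edge w v) : u = w := by
  by_contra hne
  by_cases h : T.le u w ∨ T.le w u
  · rcases h with h | h
    · exact T.edge_minimal u v hu ⟨w, ⟨Ne.symm hne, T.ne_of_edge hw⟩, h, T.le_of_edge hw⟩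
    · exact T.edge_minimal w v hw ⟨u, ⟨hne, T.ne_of_edge hu⟩, h, T.le_of_edge hu⟩
  · rcases (T.comparability u w).2 h with h | h
    · exact T.left_irrefl v (T.inheritance _ _ _ _ h (T.le_of_edge hu) (T.le_of_edge hw))
    · exact T.left_irrefl v (T.inheritance _ _ _ _ h (T.le_of_edge hw) (T.le_of_edge hu))

theorem child_unique {a b b' c : Fin n} (hb : T.edge a b) (hb' : T.edge a b')
    (h : T.le b c) (h' : T.le b' c) : b = b' := by
  by_contra hne
  by_cases hc : T.le b b' ∨ T.le b' b
  · rcases hc with hc | hc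
    · exact T.edge_minimal a b' hb' ⟨b, ⟨(T.ne_of_edge hb).symm, hne⟩, T.le_of_edge hb, hc⟩
    · exact T.edge_minimal a b hb
        ⟨b', ⟨(T.ne_of_edge hb').symm, Ne.symm hne⟩, T.le_of_edge hb', hc⟩
  · rcases (T.comparability b b').2 hc with hc | hc
    · exact T.left_irrefl c (T.inheritance _ _ _ _ hc h h')
    · exact T.left_irrefl c (T.inheritance _ _ _ _ hc h' h)

theorem le_iff {a c : Fin n} : T.le a c ↔ a = c ∨ ∃ b, T.edge a b ∧ T.le b c := by
  constructor
  · intro h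
    rcases Relation.ReflTransGen.cases_head h with h | ⟨b, hb, h⟩
    · exact Or.inl h
    · exact Or.inr ⟨b, hb, h⟩
  · rintro (rfl | ⟨b, hb, h⟩)
    · exact T.le_refl _
    · exact T.le_trans (T.le_of_edge hb) h

theorem not_le_parent {a b : Fin n} (h : T.edge a b) : ¬ T.le b a := fun h' =>
  T.ne_of_edge h (T.le_antisymm (T.le_of_edge h) h')

theorem card_edge : Fintype.card T.Edge + 1 = n := by
  classical
  have e : T.Edge ≃ {v : Fin n // v ≠ T.root} :=
    Equiv.ofBijective
      (fun e => ⟨e.1.2, fun h => T.not_edge_root e.1.1 (by rw [← h]; exact e.2)⟩) (by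
      constructor
      · rintro ⟨⟨u, v⟩, h⟩ ⟨⟨u', v'⟩, h'⟩ heq
        have hv : v = v' := congrArg Subtype.val heq
        subst hv
        have hu : u = u' := T.parent_unique h h'
        subst hu
        rfl
      · rintro ⟨v, hv⟩
        rcases Relation.ReflTransGen.cases_tail (T.root_le v) with h | ⟨u, -, h⟩
        · exact absurd h hv
        · exact ⟨⟨(u, v), h⟩, rfl⟩)
  have hn : 0 < n := Fin.pos T.root
  rw [Fintype.card_congr e, Fintype.card_subtype_compl, Fintype.card_subtype_eq, Fintype.card_fin]
  omega

/-- A coloring of `T` for arities `q`: every edge `(a, b)` is assigned an input slot of `a`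
(slots are numbered from `0`), increasingly with respect to the left-to-right order. -/
def Coloring (q : Fin n → ℕ) : Type :=
  {I : ∀ e : T.Edge, Fin (q e.1.1) // ∀ (t u v : Fin n) (hu : T.edge t u) (hv : T.edge t v),
    T.left u v → I ⟨(t, u), hu⟩ < I ⟨(t, v), hv⟩}

noncomputable instance (q : Fin n → ℕ) : Fintype (T.Coloring q) := by
  classical
  exact inferInstanceAs (Fintype {I : ∀ e : T.Edge, Fin (q e.1.1) // _})

namespace Coloring

variable {T} {q : Fin n → ℕ} (I : T.Coloring q)

theorem slot_injective {t u v : Fin n} (hu : T.edge t u) (hv : T.edge t v)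
    (h : I.1 ⟨(t, u), hu⟩ = I.1 ⟨(t, v), hv⟩) : u = v := by
  by_contra hne
  by_cases hc : T.le u v ∨ T.le v u
  · rcases hc with hc | hc
    · exact hne (T.child_unique hu hv hc (T.le_refl v))
    · exact hne (T.child_unique hu hv (T.le_refl u) hc)
  · rcases (T.comparability u v).2 hc with hc | hc
    · exact absurd h (I.2 t u v hu hv hc).ne
    · exact absurd h (I.2 t v u hv hu hc).ne'

/-- The child of `a` that is attached to the `j`-th slot of `a`, if there is one. -/
def childAt (a : Fin n) (j : ℕ) : Option (Fin n) :=
  (List.finRange n).find? fun b =>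
    if h : T.edge a b then decide ((I.1 ⟨(a, b), h⟩ : ℕ) = j) else false

theorem childAt_eq_some {a b : Fin n} {j : ℕ} :
    I.childAt a j = some b ↔ ∃ h : T.edge a b, (I.1 ⟨(a, b), h⟩ : ℕ) = j := by
  have key : ∀ c, I.childAt a j = some c → ∃ h : T.edge a c, (I.1 ⟨(a, c), h⟩ : ℕ) = j := by
    intro c hc
    have := List.find?_some hc
    by_cases he : T.edge a c
    · simp only [he, dite_true, decide_eq_true_eq] at this
      exact ⟨he, this⟩
    · simp [he] at this
  constructor
  · exact key b
  · rintro ⟨h, hj⟩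
    cases hc : I.childAt a j with
    | none =>
      have := List.find?_eq_none.1 hc b (List.mem_finRange b)
      simp [h, hj] at this
    | some c =>
      obtain ⟨h', hj'⟩ := key c hc
      rw [I.slot_injective h h' (Fin.ext (hj.trans hj'.symm))]

theorem edge_of_childAt {a b : Fin n} {j : ℕ} (h : I.childAt a j = some b) : T.edge a b :=
  (I.childAt_eq_some.1 h).1

/-- The input slots to which no child is attached. -/
abbrev FreeSlot : Type := {s : (Σ a : Fin n, Fin (q a)) // I.childAt s.1 s.2 = none}

/-- The free slots below `a`, in planar order (from left to right). -/
def slots (a : Fin n) : List I.FreeSlot :=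
  (List.finRange (q a)).flatMap fun (j : Fin (q a)) =>
    match h : I.childAt a j with
    | some b => slots b
    | none => [⟨⟨a, j⟩, h⟩]
termination_by T.size a
decreasing_by exact T.size_lt (I.edge_of_childAt h)

theorem mem_slots (s : I.FreeSlot) (a : Fin n) : s ∈ I.slots a ↔ T.le a s.1.1 := by
  induction hk : T.size a using Nat.strong_induction_on generalizing a with
  | _ k ih =>
  subst hk
  rw [slots, List.mem_flatMap, T.le_iff]
  constructor
  · rintro ⟨j, -, hj⟩
    split at hj
    · rename_i b hb
      have he := I.edge_of_childAt hb
      exact Or.inr ⟨b, he, (ih _ (T.size_lt he) b rfl).1 hj⟩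
    · rw [List.mem_singleton] at hj
      subst hj
      exact Or.inl rfl
  · rintro (h | ⟨b, he, h⟩)
    · obtain ⟨⟨c, j⟩, hs⟩ := s
      simp only at h
      subst h
      refine ⟨j, List.mem_finRange j, ?_⟩
      split
      · rename_i b hb
        simp only at hs
        rw [hs] at hb
        cases hb
      · simp
    · refine ⟨I.1 ⟨(a, b), he⟩, List.mem_finRange _, ?_⟩
      have hb : I.childAt a (I.1 ⟨(a, b), he⟩ : ℕ) = some b := I.childAt_eq_some.2 ⟨he, rfl⟩
      split
      · rename_i b' hb'
        rw [hb] at hb'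
        cases hb'
        exact (ih _ (T.size_lt he) b rfl).2 h
      · rename_i hb'
        rw [hb] at hb'
        cases hb'

theorem nodup_slots (a : Fin n) : (I.slots a).Nodup := by
  induction hk : T.size a using Nat.strong_induction_on generalizing a with
  | _ k ih =>
  subst hk
  rw [slots, List.nodup_flatMap]
  constructor
  · intro j _
    split
    · rename_i b hb
      exact ih _ (T.size_lt (I.edge_of_childAt hb)) b rfl
    · exact List.nodup_singleton _
  · refine (List.nodup_finRange (q a)).imp ?_
    intro j j' hne s hs hs'
    beta_reduce at hs hs'
    split at hs <;> split at hs'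
    · rename_i b hb b' hb'
      have hbb : b = b' := T.child_unique (I.edge_of_childAt hb) (I.edge_of_childAt hb')
        ((I.mem_slots s b).1 hs) ((I.mem_slots s b').1 hs')
      subst hbb
      obtain ⟨_, h1⟩ := I.childAt_eq_some.1 hb
      obtain ⟨_, h2⟩ := I.childAt_eq_some.1 hb'
      exact hne (Fin.ext (h1.symm.trans h2))
    · rename_i b hb hb'
      rw [List.mem_singleton] at hs'
      subst hs'
      exact T.not_le_parent (I.edge_of_childAt hb) ((I.mem_slots _ b).1 hs)
    · rename_i hb b' hb'
      rw [List.mem_singleton] at hs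
      subst hs
      exact T.not_le_parent (I.edge_of_childAt hb') ((I.mem_slots _ b').1 hs')
    · rename_i hb hb'
      rw [List.mem_singleton] at hs hs'
      subst hs
      simp only [Subtype.mk.injEq, Sigma.mk.injEq, heq_eq_eq, true_and] at hs'
      exact hne hs'

theorem card_freeSlot : Fintype.card I.FreeSlot = ∑ a, q a + 1 - n := by
  have e : T.Edge ≃ {s : (Σ a : Fin n, Fin (q a)) // ¬ I.childAt s.1 s.2 = none} :=
    Equiv.ofBijective (fun e => ⟨⟨e.1.1, I.1 e⟩, by
        have : I.childAt e.1.1 (I.1 e : ℕ) = some e.1.2 := I.childAt_eq_some.2 ⟨e.2, rfl⟩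
        simp [this]⟩) (by
      constructor
      · rintro ⟨⟨u, v⟩, h⟩ ⟨⟨u', v'⟩, h'⟩ heq
        simp only [Subtype.mk.injEq, Sigma.mk.injEq] at heq
        obtain ⟨hu, hv⟩ := heq
        subst hu
        have := I.slot_injective h h' (eq_of_heq hv)
        subst this
        rfl
      · rintro ⟨⟨a, j⟩, hs⟩
        obtain ⟨b, hb⟩ := Option.ne_none_iff_exists'.1 hs
        obtain ⟨he, hj⟩ := I.childAt_eq_some.1 hb
        refine ⟨⟨(a, b), he⟩, ?_⟩
        simp only [Subtype.mk.injEq, Sigma.mk.injEq, heq_eq_eq, true_and]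
        exact Fin.ext hj)
  have h1 := Fintype.card_subtype_compl
    (fun s : (Σ a : Fin n, Fin (q a)) => I.childAt s.1 s.2 = none)
  have h2 := Fintype.card_subtype_le
    (fun s : (Σ a : Fin n, Fin (q a)) => I.childAt s.1 s.2 = none)
  rw [← Fintype.card_congr e, Fintype.card_sigma] at h1
  rw [Fintype.card_sigma] at h2
  simp only [Fintype.card_fin] at h1 h2
  have h3 := T.card_edge
  simp only [FreeSlot]
  omega

theorem length_slots : (I.slots T.root).length = ∑ a, q a + 1 - n := by
  classical
  rw [← I.card_freeSlot, ← List.toFinset_card_of_nodup (I.nodup_slots _), ← Finset.card_univ]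
  congr 1
  ext s
  simp [mem_slots, T.root_le]

/-- The numbering of the free slots in planar order; their number is `1 + ∑ (q a - 1)`. -/
noncomputable def slotEquiv : I.FreeSlot ≃ Fin (∑ a, q a + 1 - n) :=
  (((I.nodup_slots T.root).getEquivOfForallMemList _
    fun s => (I.mem_slots s _).2 (T.root_le _)).symm).trans (finCongr I.length_slots)

end Coloring

end PTree

/-! ## Words -/

/-- A word of degree `d` in the letters `{0, …, n-1}`: a sequence of length `n + d` in which every
letter occurs, with no two equal consecutive letters and no interlacing `u … v … u … v`. -/
structure Word (n d : ℕ) where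
  letter : Fin (n + d) → Fin n
  surjective : Function.Surjective letter
  nondegenerate : ∀ i j : Fin (n + d), (i : ℕ) + 1 = j → letter i ≠ letter j
  no_interlacing : ∀ i j k l : Fin (n + d), i < j → j < k → k < l →
    letter i = letter k → letter j = letter l → letter i = letter j

namespace Word

variable {n d : ℕ} (W : Word n d)

/-- The vertex `v` is interposed in `W` if `W = … u v … u …` for some `u`. -/
def Interposed (v : Fin n) : Prop :=
  ∃ i j k : Fin (n + d), (i : ℕ) + 1 = j ∧ j < k ∧ W.letter i = W.letter k ∧ W.letter j = v

instance : DecidablePred W.Interposed := fun v =>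
  inferInstanceAs (Decidable (∃ i j k : Fin (n + d),
    (i : ℕ) + 1 = j ∧ j < k ∧ W.letter i = W.letter k ∧ W.letter j = v))

/-- The first occurrences of the letters appear in `W` in their numerical order. -/
def Ordered : Prop :=
  ∀ a b : Fin n, a < b → ∃ i, W.letter i = a ∧ ∀ j, W.letter j = b → i < j

/-- The vertices in the reverse of the order of first occurrence in `W`
(`List.dedup` keeps last occurrences). -/
def reverseFirst : List (Fin n) := (List.ofFn W.letter).reverse.dedup

variable {p : Fin n → ℕ} {p' : ℕ}

/-- The part of the image of `ζ` that is assigned by `π` to the `m`-th letter of `W`. -/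
def block (ζ : ∀ a, Fin (p a + 1) ↪o Fin (p' + 1)) (π : ∀ a, Fin (p a + 1) → Fin (n + d))
    (m : Fin (n + d)) : Set (Fin (p' + 1)) :=
  {x | ∃ i, π (W.letter m) i = m ∧ ζ (W.letter m) i = x}

/-- `π a` maps `{0, …, p a}` onto the occurrences of `a` in `W`; the images under `ζ` of the fibres
of `π` are intervals, each one ending where the next one begins; the images of the `ζ a` cover. -/
structure IsColoring (ζ : ∀ a, Fin (p a + 1) ↪o Fin (p' + 1))
    (π : ∀ a, Fin (p a + 1) → Fin (n + d)) : Prop where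
  cover : ∀ x, ∃ a i, ζ a i = x
  image : ∀ a m, (∃ i, π a i = m) ↔ W.letter m = a
  interval : ∀ m, (W.block ζ π m).OrdConnected
  glue : ∀ m m' : Fin (n + d), (m : ℕ) + 1 = m' →
    ∃ x, IsGreatest (W.block ζ π m) x ∧ IsLeast (W.block ζ π m') x

variable (p p') in
/-- The colorings of `W` by increasing injections `ζ a : {0, …, p a} → {0, …, p'}`. -/
def Coloring : Type :=
  {ζ : ∀ a, Fin (p a + 1) ↪o Fin (p' + 1) // ∃ π, W.IsColoring ζ π}

noncomputable instance : Fintype (W.Coloring p p') := by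
  have : ∀ a, Finite (Fin (p a + 1) ↪o Fin (p' + 1)) := fun a => DFunLike.finite _
  have : Finite (W.Coloring p p') :=
    inferInstanceAs (Finite {ζ : ∀ a, Fin (p a + 1) ↪o Fin (p' + 1) // ∃ π, W.IsColoring ζ π})
  exact Fintype.ofFinite _

/-- The assignment `π` belonging to a coloring; it is determined by the coloring. -/
noncomputable def Coloring.π (ζ : W.Coloring p p') : ∀ a, Fin (p a + 1) → Fin (n + d) :=
  ζ.2.choose

variable {W}

theorem IsColoring.le_of_lt {ζ : ∀ a, Fin (p a + 1) ↪o Fin (p' + 1)}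
    {π : ∀ a, Fin (p a + 1) → Fin (n + d)} (h : W.IsColoring ζ π) {m m' : Fin (n + d)}
    (hm : m < m') {x y : Fin (p' + 1)} (hx : x ∈ W.block ζ π m) (hy : y ∈ W.block ζ π m') :
    x ≤ y := by
  obtain ⟨m', hm'⟩ := m'
  induction m' generalizing y with
  | zero => exact absurd hm (by simp [Fin.lt_def])
  | succ k ih =>
    obtain ⟨z, hz, hz'⟩ := h.glue ⟨k, by omega⟩ ⟨k + 1, hm'⟩ rfl
    rcases Nat.lt_succ_iff_lt_or_eq.1 (show (m : ℕ) < k + 1 from hm) with hlt | heq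
    · exact (ih (y := z) (by omega) hlt hz.1).trans (hz'.2 hy)
    · have : m = ⟨k, by omega⟩ := Fin.ext heq
      rw [this] at hx
      exact (hz.2 hx).trans (hz'.2 hy)

end Word

/-! ## Quilts -/

/-- A quilt of arity `n` and degree `d`: a word and a tree on the same vertices such that
`W = … u … v …` excludes that `u` is a proper descendant of `v`, and such that
`W = … u … v … u …` implies that `v` equals `u` or is to the left of `u`. -/
structure Quilt (n d : ℕ) where
  word : Word n d
  tree : PTree n
  not_descendant : ∀ i j : Fin (n + d), i < j →
    ¬ (tree.le (word.letter j) (word.letter i) ∧ word.letter j ≠ word.letter i)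
  left_of : ∀ i j k : Fin (n + d), i < j → j < k → word.letter i = word.letter k →
    word.letter j = word.letter i ∨ tree.left (word.letter j) (word.letter i)

noncomputable instance (n d : ℕ) : Fintype (Quilt n d) := by
  have : Function.Injective (fun Q : Quilt n d => (Q.word.letter, Q.tree.edge, Q.tree.left)) := by
    rintro ⟨⟨l, _, _, _⟩, ⟨e, r, _, _, _, _, _, _, _, _⟩, _, _⟩
      ⟨⟨l', _, _, _⟩, ⟨e', r', _, _, _, _, _, _, _, _⟩, _, _⟩ h
    simp only [Prod.mk.injEq] at h
    obtain ⟨rfl, rfl, rfl⟩ := h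
    rfl
  have := Finite.of_injective _ this
  exact Fintype.ofFinite _

theorem Quilt.coloring_le {n d : ℕ} (Q : Quilt n d) {p : Fin n → ℕ} {p' : ℕ}
    (ζ : Q.word.Coloring p p') {a b : Fin n} (h : Q.tree.edge a b) :
    ζ.1 a (Fin.last (p a)) ≤ ζ.1 b 0 := by
  obtain ⟨ζ, π, hπ⟩ := ζ
  have hm : Q.word.letter (π a (Fin.last (p a))) = a := (hπ.image a _).1 ⟨_, rfl⟩
  have hm' : Q.word.letter (π b 0) = b := (hπ.image b _).1 ⟨_, rfl⟩
  have hlt : π a (Fin.last (p a)) < π b 0 := by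
    have hne : π a (Fin.last (p a)) ≠ π b 0 := fun he => by
      rw [he, hm'] at hm
      exact Q.tree.ne_of_edge h hm.symm
    rcases lt_or_gt_of_ne hne with hlt | hlt
    · exact hlt
    · exfalso
      refine Q.not_descendant _ _ hlt ?_
      rw [hm, hm']
      exact ⟨Q.tree.le_of_edge h, Q.tree.ne_of_edge h⟩
  refine hπ.le_of_lt hlt ?_ ?_
  · simp only [Word.block, Set.mem_ofPred_eq]
    rw [hm]
    exact ⟨_, rfl, rfl⟩
  · simp only [Word.block, Set.mem_ofPred_eq]
    rw [hm']
    exact ⟨_, rfl, rfl⟩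

/-! ## Signs -/

/-- The sign of the permutation transforming the repetition-free list `l` into `l'`: `(-1)` to the
number of pairs of entries that occur in `l'` in the opposite order as in `l`. -/
def shuffleSign {α : Type*} [DecidableEq α] (l l' : List α) : ℤ :=
  (-1) ^ ((List.range l'.length ×ˢ List.range l'.length).countP fun ij =>
    decide (ij.1 < ij.2 ∧
      (l'[ij.2]?.elim 0 fun y => l.idxOf y) < (l'[ij.1]?.elim 0 fun x => l.idxOf x)))

/-- A vertical letter `(a, false, i)` or a horizontal letter `(a, true, i)` of the vertex `a`. -/
abbrev Letter (n : ℕ) : Type := Fin n × Bool × ℕ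

/-- The concatenation, over the vertices `a` in numerical order, of the vertical letters
`0, …, p a - 1` and the horizontal letters `1, …, q a - 1` of `a`. -/
def initialWord {n : ℕ} (p q : Fin n → ℕ) : List (Letter n) :=
  (List.finRange n).flatMap fun a =>
    ((List.range (p a)).map fun i => (a, false, i)) ++
    ((List.range (q a - 1)).map fun i => (a, true, i + 1))

namespace Quilt

variable {n d : ℕ} (Q : Quilt n d)

/-- Arities modified for the purpose of signs: `0` is replaced with `2`. -/
def signArity (q : Fin n → ℕ) (a : Fin n) : ℕ := if q a = 0 then 2 else q a

/-- Vertical degrees modified for the purpose of signs: `0` is replaced with `2` at the interposed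
vertices. -/
def signDegree (p : Fin n → ℕ) (a : Fin n) : ℕ :=
  if Q.word.Interposed a ∧ p a = 0 then 2 else p a

/-- The values `ζ a i` after expanding the coloring by `2` at each interposed vertex `b`
with `p b = 0`: what is assigned to later letters of the word is shifted by `2`. -/
def signPosition {p : Fin n → ℕ} {p' : ℕ} (ζ : ∀ a, Fin (p a + 1) ↪o Fin (p' + 1))
    (π : ∀ a, Fin (p a + 1) → Fin (n + d)) (a : Fin n) (i : ℕ) : ℕ :=
  if Q.word.Interposed a ∧ p a = 0 then
    ζ a 0 + i + 2 * ((Finset.univ.filter fun m : Fin (n + d) => m < π a 0 ∧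
      Q.word.Interposed (Q.word.letter m) ∧ p (Q.word.letter m) = 0).card)
  else
    ζ a (Fin.ofNat _ i) + 2 * ((Finset.univ.filter fun m : Fin (n + d) => m < π a (Fin.ofNat _ i) ∧
      Q.word.Interposed (Q.word.letter m) ∧ p (Q.word.letter m) = 0).card)

/-- The first vertical letters of the interposed vertices, in reverse order of first occurrence. -/
def shuffledZero : List (Letter n) :=
  (Q.word.reverseFirst.filter fun a => decide (Q.word.Interposed a)).map fun a => (a, false, 0)

/-- The other vertical letters, the `i`-th one of `a` being in position `ζ a i`. -/
def shuffledVertical {p : Fin n → ℕ} {p' : ℕ} (ζ : ∀ a, Fin (p a + 1) ↪o Fin (p' + 1))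
    (π : ∀ a, Fin (p a + 1) → Fin (n + d)) : List (Letter n) :=
  (List.range (p' + 2 * n)).flatMap fun x =>
    (List.finRange n).flatMap fun a =>
      ((List.range (Q.signDegree p a)).filter fun i =>
        decide (Q.signPosition ζ π a i = x ∧ (Q.word.Interposed a → i ≠ 0))).map
          fun i => (a, false, i)

/-- The horizontal letters of the vertices below `a` in the order in which they are passed when one
goes around the tree from the left: the slots of `a` are visited in order, at each slot the part of
the tree attached there is traversed, and between two slots the next horizontal letter of `a` is
written. -/
def shuffledHorizontal {T : PTree n} {q : Fin n → ℕ} (I : T.Coloring q) (a : Fin n) :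
    List (Letter n) :=
  (List.range (signArity q a)).flatMap fun j =>
    (match h : I.childAt a j with
      | some b => shuffledHorizontal I b
      | none => []) ++
    (if j + 1 < signArity q a then [(a, true, j + 1)] else [])
termination_by T.size a
decreasing_by exact T.size_lt (I.edge_of_childAt h)

/-- The sign of a coloring of a quilt. -/
noncomputable def sign {p q : Fin n → ℕ} {p' : ℕ} (ζ : Q.word.Coloring p p')
    (I : Q.tree.Coloring q) : ℤ :=
  shuffleSign (initialWord (Q.signDegree p) (signArity q))
    (Q.shuffledZero ++ Q.shuffledVertical ζ.1 (ζ.π) ++ shuffledHorizontal I Q.tree.root)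

end Quilt

/-! ## Diagrams of algebras and their Hochschild bicomplex -/

/-- Associative, not necessarily unital, algebras over `k`. -/
structure NUAlg (k : Type u) [CommRing k] where
  carrier : Type w
  [ring : NonUnitalRing carrier]
  [module : Module k carrier]
  [tower : IsScalarTower k carrier carrier]
  [comm : SMulCommClass k carrier carrier]

attribute [instance] NUAlg.ring NUAlg.module NUAlg.tower NUAlg.comm

instance (k : Type u) [CommRing k] : CoeSort (NUAlg.{u, w} k) (Type w) := ⟨NUAlg.carrier⟩

/-- The category of associative algebras and algebra homomorphisms. -/
instance (k : Type u) [CommRing k] : Category.{w} (NUAlg.{u, w} k) where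
  Hom A B := A →ₙₐ[k] B
  id A := NonUnitalAlgHom.id k A
  comp f g := NonUnitalAlgHom.comp g f

section Bicomplex

variable {k : Type u} [CommRing k] {C : Type v} [Category.{t} C] (A : C ⥤ NUAlg.{u, w} k)

/-- The linear map underlying the algebra homomorphism that a diagram assigns to a morphism. -/
def diagMap {x y : C} (g : x ⟶ y) : A.obj x →ₗ[k] A.obj y :=
  let F : A.obj x →ₙₐ[k] A.obj y := A.map g
  { toFun := F, map_add' := map_add F, map_smul' := map_smul F }

variable (C) in
/-- The `p`-simplices `x₀ ← x₁ ← ⋯ ← x_p` of the nerve of `C`. -/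
abbrev Chain (p : ℕ) : Type (max v t) := (Fin (p + 1))ᵒᵖ ⥤ C

namespace Chain

variable {p p' : ℕ} (φ : Chain C p)

/-- The object `x_i` of a chain. -/
abbrev vertex (i : Fin (p + 1)) : C := φ.obj (op i)

/-- The composed morphism `x_i ← x_j` of a chain, for `i ≤ j`. -/
abbrev arrow {i j : Fin (p + 1)} (h : i ≤ j) : φ.vertex j ⟶ φ.vertex i := φ.map (homOfLE h).op

/-- The pullback `ζ^* φ` of a chain along an increasing injection. -/
abbrev pull (ζ : Fin (p + 1) ↪o Fin (p' + 1)) (φ : Chain C p') : Chain C p :=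
  ζ.monotone.functor.op ⋙ φ

end Chain

/-- `C^{p,q}(A, A)`: a `q`-linear map `A(x_p)^q → A(x₀)` for every chain `x₀ ← ⋯ ← x_p`. -/
abbrev Cochain (p q : ℕ) : Type (max v w t) :=
  (φ : Chain C p) → MultilinearMap k (fun _ : Fin q => A.obj (φ.vertex (Fin.last p)))
    (A.obj (φ.vertex 0))

section Composition

variable {A} {n : ℕ} {T : PTree n} {p q : Fin n → ℕ} {p' : ℕ}
  (f : ∀ a, Cochain A (p a) (q a)) (ζ : ∀ a, Fin (p a + 1) ↪o Fin (p' + 1))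
  (h : ∀ a b, T.edge a b → ζ a (Fin.last (p a)) ≤ ζ b 0) (I : T.Coloring q) (φ : Chain C p')

/-- The composition of the maps `f b [ζ b ^* φ]` for the vertices `b` of `T` below `a`. The slots to
which a child is attached receive the value at the child, the free slots receive the inputs `x`;
the diagram `A` is used to pass from one vector space to another. -/
def composeAt (x : I.FreeSlot → A.obj (φ.vertex (Fin.last p'))) (a : Fin n) :
    A.obj (φ.vertex (ζ a 0)) :=
  f a (Chain.pull (ζ a) φ) fun j : Fin (q a) =>
    match hj : I.childAt a j with
    | some b => diagMap A (φ.arrow (h a b (I.edge_of_childAt hj))) (composeAt x b)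
    | none => diagMap A (φ.arrow (Fin.le_last (ζ a (Fin.last (p a))))) (x ⟨⟨a, j⟩, hj⟩)
termination_by T.size a
decreasing_by exact T.size_lt (I.edge_of_childAt hj)

theorem composeAt_congr (x y : I.FreeSlot → A.obj (φ.vertex (Fin.last p'))) (a : Fin n)
    (hxy : ∀ s : I.FreeSlot, T.le a s.1.1 → x s = y s) :
    composeAt f ζ h I φ x a = composeAt f ζ h I φ y a := by
  induction hk : T.size a using Nat.strong_induction_on generalizing a with
  | _ k ih =>
  subst hk
  rw [composeAt, composeAt]
  congr 1
  funext j
  split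
  · rename_i b hb
    have he := I.edge_of_childAt hb
    rw [ih _ (T.size_lt he) b (fun s hs => hxy s (T.le_trans (T.le_of_edge he) hs)) rfl]
  · rw [hxy _ (T.le_refl a)]

/-- The value at the slot `j` in the definition of `composeAt`. -/
def slotValue (x : I.FreeSlot → A.obj (φ.vertex (Fin.last p'))) (a : Fin n) (j : Fin (q a)) :
    A.obj (φ.vertex (ζ a (Fin.last (p a)))) :=
  match hj : I.childAt a j with
  | some b => diagMap A (φ.arrow (h a b (I.edge_of_childAt hj))) (composeAt f ζ h I φ x b)
  | none => diagMap A (φ.arrow (Fin.le_last (ζ a (Fin.last (p a))))) (x ⟨⟨a, j⟩, hj⟩)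

theorem composeAt_eq (x : I.FreeSlot → A.obj (φ.vertex (Fin.last p'))) (a : Fin n) :
    composeAt f ζ h I φ x a =
      f a (Chain.pull (ζ a) φ) (fun j => slotValue f ζ h I φ x a j) := by
  rw [composeAt]; rfl

theorem slotValue_some (x : I.FreeSlot → A.obj (φ.vertex (Fin.last p'))) (a : Fin n)
    (j : Fin (q a)) {b : Fin n} (hb : I.childAt a j = some b) :
    slotValue f ζ h I φ x a j =
      diagMap A (φ.arrow (h a b (I.edge_of_childAt hb))) (composeAt f ζ h I φ x b) := by
  unfold slotValue
  split
  · rename_i b' hb'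
    rw [hb] at hb'
    cases hb'
    rfl
  · rename_i hb'
    rw [hb] at hb'
    cases hb'

theorem slotValue_none (x : I.FreeSlot → A.obj (φ.vertex (Fin.last p'))) (a : Fin n)
    (j : Fin (q a)) (hb : I.childAt a j = none) :
    slotValue f ζ h I φ x a j =
      diagMap A (φ.arrow (Fin.le_last (ζ a (Fin.last (p a))))) (x ⟨⟨a, j⟩, hb⟩) := by
  unfold slotValue
  split
  · rename_i b' hb'
    rw [hb] at hb'
    cases hb'
  · rfl

/-- A slot such that only the value there depends on the input at the free slot `s`. -/
theorem exists_slot (s : I.FreeSlot) (a : Fin n) (hs : T.le a s.1.1) : ∃ j₀ : Fin (q a),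
    (∀ (x y : I.FreeSlot → A.obj (φ.vertex (Fin.last p'))), (∀ s', s' ≠ s → x s' = y s') →
      ∀ j, j ≠ j₀ → slotValue f ζ h I φ x a j = slotValue f ζ h I φ y a j) ∧
    ((∃ b, I.childAt a j₀ = some b ∧ T.le b s.1.1) ∨
      (∃ hn : I.childAt a j₀ = none, s = ⟨⟨a, j₀⟩, hn⟩)) := by
  rcases T.le_iff.1 hs with hs | ⟨b, he, hb⟩
  · obtain ⟨⟨c, j₀⟩, hn⟩ := s
    simp only at hs
    subst hs
    refine ⟨j₀, ?_, Or.inr ⟨hn, rfl⟩⟩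
    intro x y hxy j hj
    cases hc : I.childAt a j with
    | none =>
      rw [slotValue_none _ _ _ _ _ _ _ _ hc, slotValue_none _ _ _ _ _ _ _ _ hc, hxy]
      intro heq
      simp only [Subtype.mk.injEq, Sigma.mk.injEq, heq_eq_eq, true_and] at heq
      exact hj heq
    | some b =>
      rw [slotValue_some _ _ _ _ _ _ _ _ hc, slotValue_some _ _ _ _ _ _ _ _ hc,
        composeAt_congr f ζ h I φ x y b]
      intro s' hs'
      apply hxy
      rintro rfl
      exact T.not_le_parent (I.edge_of_childAt hc) hs'
  · have hj₀ : I.childAt a (I.1 ⟨(a, b), he⟩ : ℕ) = some b := I.childAt_eq_some.2 ⟨he, rfl⟩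
    refine ⟨I.1 ⟨(a, b), he⟩, ?_, Or.inl ⟨b, hj₀, hb⟩⟩
    intro x y hxy j hj
    cases hc : I.childAt a j with
    | none =>
      rw [slotValue_none _ _ _ _ _ _ _ _ hc, slotValue_none _ _ _ _ _ _ _ _ hc, hxy]
      rintro rfl
      exact T.not_le_parent he hb
    | some b' =>
      rw [slotValue_some _ _ _ _ _ _ _ _ hc, slotValue_some _ _ _ _ _ _ _ _ hc,
        composeAt_congr f ζ h I φ x y b']
      intro s' hs'
      apply hxy
      rintro rfl
      obtain ⟨he', hj'⟩ := I.childAt_eq_some.1 hc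
      have hbb := T.child_unique he he' hb hs'
      subst hbb
      exact hj (Fin.ext hj'.symm)

open Function in
theorem composeAt_add [DecidableEq I.FreeSlot]
    (m : I.FreeSlot → A.obj (φ.vertex (Fin.last p'))) (s : I.FreeSlot)
    (x y : A.obj (φ.vertex (Fin.last p'))) (a : Fin n) (hs : T.le a s.1.1) :
    composeAt f ζ h I φ (update m s (x + y)) a =
      composeAt f ζ h I φ (update m s x) a + composeAt f ζ h I φ (update m s y) a := by
  induction hk : T.size a using Nat.strong_induction_on generalizing a with
  | _ k ih =>
  subst hk
  obtain ⟨j₀, hj, hcase⟩ := exists_slot f ζ h I φ s a hs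
  have upd : ∀ z, (fun j => slotValue f ζ h I φ (update m s z) a j) =
      update (fun j => slotValue f ζ h I φ m a j) j₀
        (slotValue f ζ h I φ (update m s z) a j₀) := by
    intro z
    funext j
    by_cases hjj : j = j₀
    · subst hjj; simp
    · rw [update_of_ne hjj]
      exact hj _ _ (fun s' hs' => update_of_ne hs' _ _) j hjj
  have lin : slotValue f ζ h I φ (update m s (x + y)) a j₀ =
      slotValue f ζ h I φ (update m s x) a j₀ + slotValue f ζ h I φ (update m s y) a j₀ := by
    rcases hcase with ⟨b, hb, hle⟩ | ⟨hn, rfl⟩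
    · simp only [slotValue_some _ _ _ _ _ _ _ _ hb]
      rw [ih _ (T.size_lt (I.edge_of_childAt hb)) b hle rfl, map_add]
    · simp only [slotValue_none _ _ _ _ _ _ _ _ hn, update_self, map_add]
  rw [composeAt_eq, composeAt_eq, composeAt_eq, upd (x + y), upd x, upd y, lin]
  exact MultilinearMap.map_update_add (f a (Chain.pull (ζ a) φ)) _ j₀ _ _

open Function in
theorem composeAt_smul [DecidableEq I.FreeSlot]
    (m : I.FreeSlot → A.obj (φ.vertex (Fin.last p'))) (s : I.FreeSlot) (c : k)
    (x : A.obj (φ.vertex (Fin.last p'))) (a : Fin n) (hs : T.le a s.1.1) :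
    composeAt f ζ h I φ (update m s (c • x)) a =
      c • composeAt f ζ h I φ (update m s x) a := by
  induction hk : T.size a using Nat.strong_induction_on generalizing a with
  | _ k ih =>
  subst hk
  obtain ⟨j₀, hj, hcase⟩ := exists_slot f ζ h I φ s a hs
  have upd : ∀ z, (fun j => slotValue f ζ h I φ (update m s z) a j) =
      update (fun j => slotValue f ζ h I φ m a j) j₀
        (slotValue f ζ h I φ (update m s z) a j₀) := by
    intro z
    funext j
    by_cases hjj : j = j₀
    · subst hjj; simp
    · rw [update_of_ne hjj]
      exact hj _ _ (fun s' hs' => update_of_ne hs' _ _) j hjj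
  have lin : slotValue f ζ h I φ (update m s (c • x)) a j₀ =
      c • slotValue f ζ h I φ (update m s x) a j₀ := by
    rcases hcase with ⟨b, hb, hle⟩ | ⟨hn, rfl⟩
    · simp only [slotValue_some _ _ _ _ _ _ _ _ hb]
      rw [ih _ (T.size_lt (I.edge_of_childAt hb)) b hle rfl, map_smul]
    · simp only [slotValue_none _ _ _ _ _ _ _ _ hn, update_self, map_smul]
  rw [composeAt_eq, composeAt_eq, upd (c • x), upd x, lin]
  exact MultilinearMap.map_update_smul (f a (Chain.pull (ζ a) φ)) _ j₀ _ _

/-- The composition of the cochains `f a` along the tree `T`, with the slots given by `I` and the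
simplicial operators given by `ζ`. The free slots are the inputs, in planar order. -/
noncomputable def compose : Cochain A p' (∑ a, q a + 1 - n) := fun φ =>
  MultilinearMap.domDomCongr I.slotEquiv
    { toFun := fun x : I.FreeSlot → A.obj (φ.vertex (Fin.last p')) =>
        diagMap A (φ.arrow (Fin.zero_le (ζ T.root 0))) (composeAt f ζ h I φ x T.root)
      map_update_add' := fun m s x y => by
        rw [composeAt_add _ _ _ _ _ _ _ _ _ _ (T.root_le _), map_add]
      map_update_smul' := fun m s c x => by
        rw [composeAt_smul _ _ _ _ _ _ _ _ _ _ (T.root_le _), map_smul] }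

end Composition

/-- The action `Q̂(f₀, …, f_{n-1})` of a quilt on homogeneous cochains: the sum over all colorings,
with signs, of the compositions of the cochains. -/
noncomputable def Quilt.act {A : C ⥤ NUAlg.{u, w} k} {n d : ℕ} (Q : Quilt n d) {p q : Fin n → ℕ}
    (f : ∀ a, Cochain A (p a) (q a)) : Cochain A (∑ a, p a - d) (∑ a, q a + 1 - n) :=
  ∑ ζ : Q.word.Coloring p (∑ a, p a - d), ∑ I : Q.tree.Coloring q,
    Q.sign ζ I • compose f ζ.1 (fun _ _ h => Q.coloring_le ζ h) I

/-- The total space of the Hochschild bicomplex: the direct sum of all `C^{p,q}(A, A)`. -/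
abbrev Tot : Type (max v w t) := DirectSum (ℕ × ℕ) fun b => Cochain A b.1 b.2

variable {A}

/-- The element of the total space given by a homogeneous cochain. -/
noncomputable def Cochain.toTot {p q : ℕ} (f : Cochain A p q) : Tot A :=
  DirectSum.of (fun b : ℕ × ℕ => Cochain A b.1 b.2) (p, q) f

/-- `f` is homogeneous of shifted total degree `p + q - 1 = e`. -/
def Tot.HasDegree (f : Tot A) (e : ℤ) : Prop :=
  ∀ p q : ℕ, f (p, q) ≠ 0 → (p : ℤ) + q - 1 = e

variable (A) in
/-- The asimplicial subcomplex: the components of bidegree `(p, 0)` vanish. -/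
def asimplicial : Submodule k (Tot A) where
  carrier := {f | ∀ p : ℕ, f (p, 0) = 0}
  zero_mem' := fun _ => rfl
  add_mem' := fun {f g} hf hg p => by rw [DirectSum.add_apply, hf p, hg p, add_zero]
  smul_mem' := fun c f hf p => by rw [DirectSum.smul_apply, hf p, smul_zero]

open Classical in
/-- The multilinear extension of the action of a quilt to the total space. -/
noncomputable def Quilt.hat {n d : ℕ} (Q : Quilt n d) (f : Fin n → Tot A) : Tot A :=
  ∑ b ∈ Fintype.piFinset fun a => (f a).support,
    (Q.act (p := fun a => (b a).1) (q := fun a => (b a).2) fun a => f a (b a)).toTot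

/-- The cochain `δ_i f`, for the `i`-th face map: `f` is evaluated on the chain in which `x_i` is
omitted, and `A` is applied to the remaining morphisms at the ends. -/
noncomputable def faceCoboundary {p q : ℕ} (i : Fin (p + 2)) (f : Cochain A p q) :
    Cochain A (p + 1) q := fun φ =>
  (diagMap A (φ.arrow (Fin.zero_le (Fin.succAboveOrderEmb i 0)))).compMultilinearMap
    ((f (Chain.pull (Fin.succAboveOrderEmb i) φ)).compLinearMap fun _ =>
      diagMap A (φ.arrow (Fin.le_last (Fin.succAboveOrderEmb i (Fin.last p)))))

/-- The simplicial coboundary of a homogeneous cochain. -/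
noncomputable def simplicialCoboundary {p q : ℕ} (f : Cochain A p q) : Cochain A (p + 1) q :=
  ∑ i : Fin (p + 2), (-1 : ℤ) ^ (i : ℕ) • faceCoboundary i f

open Classical in
/-- The simplicial coboundary `δ^S` on the total space. -/
noncomputable def deltaS (f : Tot A) : Tot A :=
  ∑ b ∈ f.support, (simplicialCoboundary (f b)).toTot

variable (A) in
/-- The multiplication, as a cochain of bidegree `(0, 2)`. -/
def mulCochain : Cochain A 0 2 := fun φ =>
  { toFun := fun x => (x 0 * x 1 : A.obj (φ.vertex 0))
    map_update_add' := by
      intro _ m i x y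
      fin_cases i
      · simp [add_mul]
      · simp [mul_add]
    map_update_smul' := by
      intro _ m i c x
      fin_cases i
      · simp [smul_mul_assoc]
      · simp [mul_smul_comm] }

variable (A) in
/-- The multiplication `m̂` as an element of the total space. -/
noncomputable def mHat : Tot A := (mulCochain A).toTot

end Bicomplex

/-! ## The particular quilts -/

/-- A tree of depth at most two, given by its edges, left-to-right relation and ancestor order. -/
def PTree.ofDepthTwo {n : ℕ} (edge left le : Fin n → Fin n → Bool) (r : Fin n)
    (h₁ : ∀ u v w, le u v → edge v w → le u w)
    (h₂ : ∀ u v, le u v ↔ (u = v ∨ edge u v ∨ ∃ w, edge u w ∧ edge w v))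
    (h₃ : ∀ u, ¬ edge u u) (h₄ : ∀ u v, le u v → le v u → u = v) (h₅ : ∀ u, le r u)
    (h₆ : ∀ u v, edge u v → ¬ ∃ t, (t ≠ u ∧ t ≠ v) ∧ le u t ∧ le t v)
    (h₇ : ∀ u, ¬ left u u) (h₈ : ∀ u v w, left u v → left v w → left u w)
    (h₉ : ∀ u v, (left u v ∨ left v u) ↔ ¬ (le u v ∨ le v u))
    (h₁₀ : ∀ u v u' v', left u v → le u u' → le v v' → left u' v') : PTree n :=
  have key : ∀ u v, Relation.ReflTransGen (fun a b => edge a b = true) u v ↔ le u v = true := by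
    intro u v
    constructor
    · intro h
      induction h with
      | refl => exact (h₂ u u).2 (Or.inl rfl)
      | tail _ h ih => exact h₁ _ _ _ ih h
    · intro h
      rcases (h₂ u v).1 h with rfl | h | ⟨w, h, h'⟩
      · exact .refl
      · exact .single h
      · exact .tail (.single h) h'
  { edge := edge
    left := left
    edge_irrefl := h₃
    le_antisymm' := by simpa only [key] using h₄
    root_unique := by
      simp only [key]
      exact ⟨r, fun u hu => h₄ _ _ hu (h₅ u), fun s hs => (hs r (h₅ s)).symm⟩
    edge_minimal := by simpa only [key] using h₆
    left_irrefl := h₇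
    left_trans := h₈
    comparability := by simpa only [key] using h₉
    inheritance := by simpa only [key] using h₁₀ }

theorem PTree.le_ofDepthTwo {n : ℕ} (edge left le : Fin n → Fin n → Bool) (r : Fin n)
    (h₁ h₂ h₃ h₄ h₅ h₆ h₇ h₈ h₉ h₁₀) (u v : Fin n) :
    (PTree.ofDepthTwo edge left le r h₁ h₂ h₃ h₄ h₅ h₆ h₇ h₈ h₉ h₁₀).le u v ↔ le u v = true := by
  constructor
  · intro h
    induction h with
    | refl => exact (h₂ u u).2 (Or.inl rfl)
    | tail _ h ih => exact h₁ _ _ _ ih h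
  · intro h
    rcases (h₂ u v).1 h with rfl | h | ⟨w, h, h'⟩
    · exact .refl
    · exact .single h
    · exact .tail (.single h) h'

/-- The quilt with word `1 2` and tree `1 → 2` (with the vertices numbered from `1`). -/
def quilt12 : Quilt 2 0 where
  word :=
    { letter := ![0, 1]
      surjective := by decide
      nondegenerate := by decide
      no_interlacing := by decide }
  tree := PTree.ofDepthTwo (fun u v => decide (u = 0 ∧ v = 1)) (fun _ _ => false)
    (fun u v => decide (u = v ∨ u = 0)) 0 (by decide) (by decide) (by decide) (by decide)
    (by decide) (by decide) (by decide) (by decide) (by decide) (by decide)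
  not_descendant := by simp only [PTree.le_ofDepthTwo]; decide
  left_of := by decide

/-- The quilt with word `2 1` and tree `2 → 1` (with the vertices numbered from `1`). -/
def quilt21 : Quilt 2 0 where
  word :=
    { letter := ![1, 0]
      surjective := by decide
      nondegenerate := by decide
      no_interlacing := by decide }
  tree := PTree.ofDepthTwo (fun u v => decide (u = 1 ∧ v = 0)) (fun _ _ => false)
    (fun u v => decide (u = v ∨ u = 1)) 1 (by decide) (by decide) (by decide) (by decide)
    (by decide) (by decide) (by decide) (by decide) (by decide) (by decide)
  not_descendant := by simp only [PTree.le_ofDepthTwo]; decide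
  left_of := by decide

/-- The quilt with word `1 2 3 2 4 2` and tree with edges `1 → 3`, `1 → 2`, `3 → 4`, where `3` and
`4` are to the left of `2` (with the vertices numbered from `1`). -/
def quilt1324 : Quilt 4 2 where
  word :=
    { letter := ![0, 1, 2, 1, 3, 1]
      surjective := by decide
      nondegenerate := by decide
      no_interlacing := by decide }
  tree := PTree.ofDepthTwo
    (fun u v => decide ((u = 0 ∧ v = 2) ∨ (u = 0 ∧ v = 1) ∨ (u = 2 ∧ v = 3)))
    (fun u v => decide ((u = 2 ∨ u = 3) ∧ v = 1))
    (fun u v => decide (u = v ∨ u = 0 ∨ (u = 2 ∧ v = 3))) 0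
    (by decide) (by decide) (by decide) (by decide)
    (by decide) (by decide) (by decide) (by decide) (by decide) (by decide)
  not_descendant := by simp only [PTree.le_ofDepthTwo]; decide
  left_of := by decide

/-! ## The Maurer-Cartan equation -/

section MaurerCartan

variable {k : Type u} [CommRing k] {C : Type v} [Category.{t} C] {A : C ⥤ NUAlg.{u, w} k}

/-- The Hochschild coboundary `δ^H`. -/
noncomputable def deltaH (f : Tot A) : Tot A :=
  quilt12.hat ![mHat A, f] - quilt21.hat ![mHat A, f]

/-- The coboundary `δ = δ^S + δ^H` of the Hochschild complex. -/
noncomputable def delta (f : Tot A) : Tot A := deltaS f + deltaH f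

open Classical in
/-- The action of `P⁰_n`, that is, of `(-1)^{1+n(n-1)/2}` times the sum of all quilts of arity `n`
and degree `n - 2` whose vertices are labelled in the order of first occurrence (`n ≥ 2`). -/
noncomputable def hatPZero (n : ℕ) (f : Fin n → Tot A) : Tot A :=
  (-1 : ℤ) ^ (1 + n * (n - 1) / 2) •
    ∑ Q : Quilt n (n - 2) with Q.word.Ordered, Q.hat f

/-- The action of `P_n = P⁰_n + P⁰_{n+1} ∘₁ m`, where `m` acts as the multiplication. -/
noncomputable def hatP (n : ℕ) (f : Fin n → Tot A) : Tot A :=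
  hatPZero n f + hatPZero (n + 1) (Fin.cons (mHat A) f)

/-- The right-hand side `δ f + ∑_{n ≥ 2} P̂_n(f, …, f)` of the Maurer-Cartan equation vanishes: the
series has only finitely many nonzero terms and its sum is `0`. -/
def MaurerCartan (f : Tot A) : Prop :=
  {n : ℕ | 2 ≤ n ∧ hatP n (fun _ => f) ≠ 0}.Finite ∧
    delta f + ∑ᶠ (n : ℕ) (_ : 2 ≤ n), hatP n (fun _ => f) = 0

end MaurerCartan

end HochschildQuilt

open HochschildQuilt

/-!
Let `Q` be a quilt of arity `n ≥ 4` and degree `n - 2` which has a coloring for some bidegrees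
`(p a, q a)` with `p a + q a = 2`. Signs and values of cochains play no role: it is shown that such
a `Q` exists only for `n = 4`, and that it is `quilt1324` if it is labelled in order of first
occurrence.

The root `r` of the tree is the first letter of the word and does not recur, and the degree `n - 2`
is the largest one possible for the remaining `n - 1` letters: a letter that is not a first
occurrence follows a last occurrence, and by counting, every last occurrence except the root and
the end of the word is followed by a letter that is not a first occurrence
(`Word.exists_lt_of_last`). Hence the word ends with its second letter `s`. All letters except `r`
and `s` are enclosed by occurrences of `s`, hence to the left of `s` in the tree, and `s` is a leaf
attached to the root. As the root has at most two slots, it has one more child `c`, and all other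
vertices lie below `c`.

A vertex `v ≠ r, s` that is comparable in the tree to all vertices except `s` occurs only in
`… s v s …` (`Quilt.enclosed_of_comparable`). The interval of such a `v` has positive length, so
`p v ≥ 1` and `q v ≤ 1`, and `v` has at most one child; this child is then again comparable to all
vertices except `s`. Starting with `c`, one finds that the vertices other than `r` and `s` form a
chain `c, e, …` in the tree, and that `m` of them need `m + 1` occurrences of `s`. As `s` occurs at
most `p s + 1 ≤ 3` times, there are exactly two of them, so that `n = 4`, `p s = 2`, `q s = 0`, and
the word is `r s c s e s` (`Quilt.structure_of_coloring`, `Quilt.eq_quilt1324`).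

Since the multiplication has shifted total degree `1` too, this applies to both terms of `P̂ₙ`. In
the asimplicial subcomplex the components with `q s = 0` vanish, and so does `P̂₄(f, f, f, f)`.
-/

namespace HochschildQuilt

/-! ### Words of maximal degree -/

/-- Every non-first occurrence is preceded by a last occurrence, because letters do not interlace.
If the first letter of the word does not recur, there are at most `n - 2` last occurrences which
can arise in this way; in degree `n - 2` all of them do. -/
theorem Word.exists_lt_of_last {n d : ℕ} (W : Word n d) (hd : d + 2 = n)
    (h₀ : ∀ i j : Fin (n + d), (i : ℕ) = 0 → W.letter j = W.letter i → j = i)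
    {i j : Fin (n + d)} (hi : 0 < (i : ℕ)) (hij : (i : ℕ) + 1 = j)
    (hlast : ∀ k, W.letter k = W.letter i → k ≤ i) : ∃ k < j, W.letter k = W.letter j := by
  classical
  have hfst : ∀ a, ∃ m, W.letter m = a ∧ ∀ k, W.letter k = a → m ≤ k := by
    intro a
    obtain ⟨m, hm, hmin⟩ := Set.exists_min_image {m | W.letter m = a} id (Set.toFinite _)
      (W.surjective a)
    exact ⟨m, hm, hmin⟩
  have hlst : ∀ a, ∃ m, W.letter m = a ∧ ∀ k, W.letter k = a → k ≤ m := by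
    intro a
    obtain ⟨m, hm, hmax⟩ := Set.exists_max_image {m | W.letter m = a} id (Set.toFinite _)
      (W.surjective a)
    exact ⟨m, hm, hmax⟩
  choose fst fst_letter fst_le using hfst
  choose lst lst_letter le_lst using hlst
  have hfinj : Function.Injective fst := fun a b h => by rw [← fst_letter a, h, fst_letter]
  have hlinj : Function.Injective lst := fun a b h => by rw [← lst_letter a, h, lst_letter]
  have hN : (Finset.univ \ Finset.univ.image fst).card = d := by
    rw [Finset.card_sdiff_of_subset (Finset.subset_univ _), Finset.card_image_of_injective _ hfinj]
    simp
  -- The first and the last position of the word, which are last occurrences but do not precede a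
  -- repeated letter.
  let z : Fin (n + d) := ⟨0, by omega⟩
  let y : Fin (n + d) := ⟨n + d - 1, by omega⟩
  have hE : (((Finset.univ.image lst).erase z).erase y).card = d := by
    have hz : z ∈ Finset.univ.image lst := Finset.mem_image.2
      ⟨W.letter z, Finset.mem_univ _, h₀ z _ rfl (lst_letter _)⟩
    have hy : y ∈ (Finset.univ.image lst).erase z := by
      refine Finset.mem_erase.2 ⟨by simp only [y, z, ne_eq, Fin.mk.injEq]; omega,
        Finset.mem_image.2 ⟨W.letter y, Finset.mem_univ _, le_antisymm ?_ (le_lst _ _ rfl)⟩⟩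
      rw [Fin.le_def]
      simp only [y]
      omega
    rw [Finset.card_erase_of_mem hy, Finset.card_erase_of_mem hz,
      Finset.card_image_of_injective _ hlinj, Finset.card_univ, Fintype.card_fin]
    omega
  have hmem : ∀ m, m ∈ Finset.univ \ Finset.univ.image fst ↔ ∃ k < m, W.letter k = W.letter m := by
    intro m
    simp only [Finset.mem_sdiff, Finset.mem_univ, true_and, Finset.mem_image, not_exists]
    constructor
    · intro h
      exact ⟨fst (W.letter m), lt_of_le_of_ne (fst_le _ _ rfl) (h _), fst_letter _⟩
    · rintro ⟨k, hk, hkm⟩ a rfl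
      rw [fst_letter] at hkm
      exact absurd (fst_le _ _ hkm) (not_le.2 hk)
  have hpos : ∀ m ∈ Finset.univ \ Finset.univ.image fst, 2 ≤ (m : ℕ) := by
    intro m hm
    obtain ⟨k, hk, hkm⟩ := (hmem m).1 hm
    rw [Fin.lt_def] at hk
    by_contra hlt
    have := h₀ k m (by omega) hkm.symm
    rw [this] at hk
    exact lt_irrefl _ hk
  let pred : Fin (n + d) → Fin (n + d) := fun m => ⟨m - 1, by omega⟩
  have hsurj := Finset.surj_on_of_inj_on_of_card_le
    (s := Finset.univ \ Finset.univ.image fst) (t := ((Finset.univ.image lst).erase z).erase y)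
    (fun m _ => pred m) (by
      intro m hm
      have h2 := hpos m hm
      obtain ⟨k, hk, hkm⟩ := (hmem m).1 hm
      rw [Fin.lt_def] at hk
      have hne : W.letter (pred m) ≠ W.letter m :=
        W.nondegenerate _ _ (by simp only [pred]; omega)
      have hk' : k < pred m := by
        refine lt_of_le_of_ne (by rw [Fin.le_def]; simp only [pred]; omega) ?_
        rintro rfl
        exact hne hkm
      refine Finset.mem_erase.2 ⟨?_, Finset.mem_erase.2 ⟨?_, Finset.mem_image.2
        ⟨W.letter (pred m), Finset.mem_univ _, ?_⟩⟩⟩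
      · simp only [pred, y, ne_eq, Fin.mk.injEq]; omega
      · simp only [pred, z, ne_eq, Fin.mk.injEq]; omega
      · by_contra hlt
        have hlt : pred m < lst (W.letter (pred m)) :=
          lt_of_le_of_ne (le_lst _ _ rfl) (Ne.symm hlt)
        have hm' : m < lst (W.letter (pred m)) := by
          refine lt_of_le_of_ne ?_ fun h => hne ?_
          · rw [Fin.lt_def] at hlt
            rw [Fin.le_def]
            simp only [pred] at hlt ⊢
            omega
          · exact (congrArg W.letter h).trans (lst_letter _) |>.symm
        exact hne ((W.no_interlacing k (pred m) m _ hk'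
          (by rw [Fin.lt_def]; simp only [pred]; omega) hm' hkm (lst_letter _).symm).symm.trans hkm))
    (by
      intro m m' hm hm' h
      have h1 := hpos m hm
      have h2 := hpos m' hm'
      simp only [pred, Fin.mk.injEq] at h
      exact Fin.ext (by omega))
    (by rw [hN, hE])
  obtain ⟨m, hm, him⟩ := hsurj i (by
    refine Finset.mem_erase.2 ⟨?_, Finset.mem_erase.2 ⟨?_, Finset.mem_image.2
      ⟨W.letter i, Finset.mem_univ _, le_antisymm (hlast _ (lst_letter _)) (le_lst _ _ rfl)⟩⟩⟩
    · intro h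
      have := congrArg Fin.val h
      simp only [y] at this
      omega
    · intro h
      have := congrArg Fin.val h
      simp only [z] at this
      omega)
  have h2 := hpos m hm
  have : m = j := Fin.ext (by
    have := congrArg Fin.val him
    simp only [pred] at this
    omega)
  exact (hmem j).1 (this ▸ hm)

/-- The occurrences of `a` in a colored word are the values of `π a`, so there are at most
`p a + 1` of them. -/
theorem Word.Coloring.card_le {n d : ℕ} {W : Word n d} {p : Fin n → ℕ} {p' : ℕ}
    (ζ : W.Coloring p p') {a : Fin n} {S : Finset (Fin (n + d))} (hS : ∀ m ∈ S, W.letter m = a) :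
    S.card ≤ p a + 1 := by
  classical
  obtain ⟨ζ, π, h⟩ := ζ
  calc S.card ≤ (Finset.univ.image (π a)).card := Finset.card_le_card fun m hm => by
        simpa using (h.image a m).2 (hS m hm)
    _ ≤ p a + 1 := Finset.card_image_le.trans (by simp)

/-- In `… s v s …` the interval of the occurrence of `v` joins two different values of `ζ s`, so it
is not a point. -/
theorem Word.Coloring.pos_of_enclosed {n d : ℕ} {W : Word n d} {p : Fin n → ℕ} {p' : ℕ}
    (ζ : W.Coloring p p') {i j l : Fin (n + d)} (hij : (i : ℕ) + 1 = j) (hjl : (j : ℕ) + 1 = l)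
    (hil : W.letter i = W.letter l) : 0 < p (W.letter j) := by
  obtain ⟨ζ, π, h⟩ := ζ
  by_contra h0
  have h0 : p (W.letter j) = 0 := by omega
  obtain ⟨x, ⟨⟨a, ha, hax⟩, -⟩, ⟨b, -, hbx⟩, -⟩ := h.glue i j hij
  obtain ⟨y, ⟨⟨b', -, hby⟩, -⟩, ⟨c, hc, hcy⟩, -⟩ := h.glue j l hjl
  have hbb : b = b' := Fin.ext (by omega)
  subst hbb
  have hxy : x = y := hbx.symm.trans hby
  subst hxy
  generalize W.letter l = s at *
  subst hil
  have hac : a = c := (ζ (W.letter i)).injective (hax.trans hcy.symm)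
  subst hac
  have := congrArg Fin.val (ha.symm.trans hc)
  omega

/-- The children of `a` in a colored tree occupy different slots of `a`. -/
theorem PTree.Coloring.card_le {n : ℕ} {T : PTree n} {q : Fin n → ℕ} (I : T.Coloring q)
    {a : Fin n} {S : Finset (Fin n)} (hS : ∀ b ∈ S, T.edge a b) : S.card ≤ q a := by
  have := Finset.card_le_card_of_injOn (s := S.attach) (t := (Finset.univ : Finset (Fin (q a))))
    (fun b => I.1 ⟨(a, b.1), hS b.1 b.2⟩) (fun _ _ => Finset.mem_coe.2 (Finset.mem_univ _)) (by
      intro b _ c _ h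
      exact Subtype.ext (I.slot_injective (hS b.1 b.2) (hS c.1 c.2) h))
  simpa using this

/-! ### Quilts of arity `n` and degree `n - 2` -/

namespace PTree

variable {n : ℕ} (T : PTree n)

theorem not_le_of_left {a b : Fin n} (h : T.left a b) : ¬ T.le a b ∧ ¬ T.le b a :=
  not_or.1 ((T.comparability a b).1 (Or.inl h))

theorem not_left_of_left {a b : Fin n} (h : T.left a b) : ¬ T.left b a := fun h' =>
  T.left_irrefl a (T.left_trans _ _ _ h h')

end PTree

namespace Quilt

variable {n d : ℕ} (Q : Quilt n d)

theorem letter_eq_root_of_lt {i j : Fin (n + d)} (hij : i < j)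
    (hj : Q.word.letter j = Q.tree.root) : Q.word.letter i = Q.tree.root := by
  by_contra hne
  refine Q.not_descendant i j hij ⟨?_, ?_⟩
  · rw [hj]; exact Q.tree.root_le _
  · rw [hj]; exact Ne.symm hne

theorem letter_eq_root_iff {i : Fin (n + d)} :
    Q.word.letter i = Q.tree.root ↔ (i : ℕ) = 0 := by
  have key : ∀ i, Q.word.letter i = Q.tree.root → (i : ℕ) = 0 := by
    intro i hi
    by_contra h0
    have hlt : (⟨i - 1, by omega⟩ : Fin (n + d)) < i := by
      rw [Fin.lt_def]; simp only; omega
    exact Q.word.nondegenerate _ i (by simp only; omega)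
      ((Q.letter_eq_root_of_lt hlt hi).trans hi.symm)
  refine ⟨key i, fun hi => ?_⟩
  obtain ⟨j, hj⟩ := Q.word.surjective Q.tree.root
  have : j = i := Fin.ext ((key j hj).trans hi.symm)
  rw [← this, hj]

theorem lt_of_le {a b : Fin n} (h : Q.tree.le a b) (hne : a ≠ b) {i j : Fin (n + d)}
    (hi : Q.word.letter i = a) (hj : Q.word.letter j = b) : i < j := by
  by_contra hlt
  rcases lt_or_eq_of_le (not_lt.1 hlt) with hlt | rfl
  · refine Q.not_descendant j i hlt ?_
    rw [hi, hj]
    exact ⟨h, hne⟩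
  · exact hne (hi.symm.trans hj)

theorem letter_last_eq_letter_one (hd : d + 2 = n) {i₁ i : Fin (n + d)} (h₁ : (i₁ : ℕ) = 1)
    (hi : (i : ℕ) + 1 = n + d) : Q.word.letter i = Q.word.letter i₁ := by
  obtain ⟨j, hj, hmax⟩ := Set.exists_max_image
    {m | Q.word.letter m = Q.word.letter i₁} id (Set.toFinite _) ⟨i₁, rfl⟩
  have hj : Q.word.letter j = Q.word.letter i₁ := hj
  have hmax : ∀ k, Q.word.letter k = Q.word.letter i₁ → k ≤ j := hmax
  have h1j : (i₁ : ℕ) ≤ j := hmax i₁ rfl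
  by_cases hji : (j : ℕ) + 1 = n + d
  · rw [← hj]
    exact congrArg _ (Fin.ext (by omega))
  exfalso
  -- Otherwise the letter after the last occurrence `j` of the second letter would have occurred
  -- before, and the two letters would interlace.
  obtain ⟨j', hj'⟩ : ∃ j' : Fin (n + d), (j : ℕ) + 1 = j' := ⟨⟨j + 1, by omega⟩, rfl⟩
  have hne : Q.word.letter j' ≠ Q.word.letter i₁ := fun h => by
    have : (j' : ℕ) ≤ j := hmax j' h
    omega
  obtain ⟨k, hk, hkj⟩ := Q.word.exists_lt_of_last hd
    (fun a b ha hab => Fin.ext (by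
      rw [ha, ← Q.letter_eq_root_iff, hab, Q.letter_eq_root_iff, ha]))
    (by omega) hj' (fun m hm => hmax m (hm.trans hj))
  have hk0 : (k : ℕ) ≠ 0 := fun h => by
    have := Q.letter_eq_root_iff.1 (hkj.symm.trans (Q.letter_eq_root_iff.2 h))
    omega
  have hk1 : k ≠ i₁ := fun h => hne (h ▸ hkj.symm)
  have hkj' : k ≠ j := fun h => hne (hkj.symm.trans (h ▸ hj))
  rw [Fin.lt_def] at hk
  rw [ne_eq, Fin.ext_iff] at hk1 hkj'
  exact hne (hkj.symm.trans (Q.word.no_interlacing i₁ k j j' (by rw [Fin.lt_def]; omega)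
    (by rw [Fin.lt_def]; omega) (by rw [Fin.lt_def]; omega) hj.symm hkj).symm)

/-- The second letter is also the last one, so its occurrences enclose all letters except the
root. -/
theorem left_letter_one (hd : d + 2 = n) {i₁ : Fin (n + d)} (h₁ : (i₁ : ℕ) = 1) {v : Fin n}
    (hr : v ≠ Q.tree.root) (hs : v ≠ Q.word.letter i₁) :
    Q.tree.left v (Q.word.letter i₁) := by
  obtain ⟨m, rfl⟩ := Q.word.surjective v
  have hm0 : (m : ℕ) ≠ 0 := fun h => hr (Q.letter_eq_root_iff.2 h)
  have hm1 : (m : ℕ) ≠ 1 := fun h => hs (congrArg _ (Fin.ext (h.trans h₁.symm)))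
  obtain ⟨y, hy⟩ : ∃ y : Fin (n + d), (y : ℕ) + 1 = n + d :=
    ⟨⟨n + d - 1, by omega⟩, by simp only; omega⟩
  have hys := Q.letter_last_eq_letter_one hd h₁ hy
  have hmy : (m : ℕ) ≠ y := fun h => hs (by rw [Fin.ext h, hys])
  exact (Q.left_of i₁ m y (by rw [Fin.lt_def]; omega) (by rw [Fin.lt_def]; omega)
    hys.symm).resolve_left hs

theorem edge_root_letter_one (hd : d + 2 = n) {i₁ : Fin (n + d)} (h₁ : (i₁ : ℕ) = 1) :
    Q.tree.edge Q.tree.root (Q.word.letter i₁) := by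
  rcases Relation.ReflTransGen.cases_tail (Q.tree.root_le (Q.word.letter i₁)) with h | ⟨u, -, h⟩
  · have := Q.letter_eq_root_iff.1 h
    omega
  · by_cases hu : u = Q.tree.root
    · rwa [← hu]
    · exact absurd (Q.tree.le_of_edge h) (Q.tree.not_le_of_left
        (Q.left_letter_one hd h₁ hu (Q.tree.ne_of_edge h))).1

theorem letter_one_le (hd : d + 2 = n) {i₁ : Fin (n + d)} (h₁ : (i₁ : ℕ) = 1) {v : Fin n}
    (h : Q.tree.le (Q.word.letter i₁) v) : v = Q.word.letter i₁ := by
  by_contra hne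
  refine (Q.tree.not_le_of_left (Q.left_letter_one hd h₁ ?_ hne)).2 h
  rintro rfl
  exact hne (Q.tree.root_spec _ h).symm

/-- A vertex `v` that is comparable in the tree to all vertices except the second letter `s` of the
word occurs in `… s v s …`: letters enclosed by occurrences of `v` and letters enclosing `v` are
incomparable to `v`, so there are none of the former and only `s` of the latter. -/
theorem enclosed_of_comparable (hd : d + 2 = n) {i₁ : Fin (n + d)} (h₁ : (i₁ : ℕ) = 1)
    {v : Fin n} (hr : v ≠ Q.tree.root) (hs : v ≠ Q.word.letter i₁)
    (hv : ∀ u, u ≠ Q.word.letter i₁ → Q.tree.le u v ∨ Q.tree.le v u) :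
    ∃ i j l : Fin (n + d), (i : ℕ) + 1 = j ∧ (j : ℕ) + 1 = l ∧ 0 < (i : ℕ) ∧
      Q.word.letter i = Q.word.letter i₁ ∧ Q.word.letter j = v ∧
      Q.word.letter l = Q.word.letter i₁ := by
  obtain ⟨y, hy⟩ : ∃ y : Fin (n + d), (y : ℕ) + 1 = n + d :=
    ⟨⟨n + d - 1, by omega⟩, by simp only; omega⟩
  have hys := Q.letter_last_eq_letter_one hd h₁ hy
  have hpos : ∀ m, Q.word.letter m = v → 1 < (m : ℕ) ∧ (m : ℕ) < y := by
    intro m hm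
    have hm0 : (m : ℕ) ≠ 0 := fun h => hr (hm.symm.trans (Q.letter_eq_root_iff.2 h))
    have hm1 : (m : ℕ) ≠ 1 := fun h =>
      hs (hm.symm.trans (congrArg _ (Fin.ext (h.trans h₁.symm))))
    have hmy : (m : ℕ) ≠ y := fun h => hs (by rw [← hm, Fin.ext h, hys])
    omega
  have hcomp : ∀ u, u ≠ Q.word.letter i₁ → ¬ Q.tree.left u v ∧ ¬ Q.tree.left v u := by
    intro u hu
    rw [← not_or, Q.tree.comparability, not_not]
    exact hv u hu
  -- A letter enclosed by two occurrences of `v` would be to the left of `v`, or would be `s` and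
  -- interlace with `v`.
  have huniq : ∀ m m', Q.word.letter m = v → Q.word.letter m' = v → ¬ m < m' := by
    intro m m' hm hm' hlt
    rw [Fin.lt_def] at hlt
    have h1 := hpos m hm
    have h2 := hpos m' hm'
    have hne := Q.word.nondegenerate m ⟨m + 1, by omega⟩ rfl
    generalize hk : (⟨m + 1, by omega⟩ : Fin (n + d)) = k at hne
    have hk : (m : ℕ) + 1 = k := congrArg Fin.val hk
    have hkm' : (k : ℕ) ≠ m' := fun h => hne (by rw [hm, ← hm', Fin.ext h])
    rcases Q.left_of m k m' (by rw [Fin.lt_def]; omega) (by rw [Fin.lt_def]; omega)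
      (hm.trans hm'.symm) with h | h
    · exact hne h.symm
    · rw [hm] at h
      refine (hcomp _ fun hks => hs ?_).1 h
      exact (hm.symm.trans (Q.word.no_interlacing i₁ m k m' (by rw [Fin.lt_def]; omega)
        (by rw [Fin.lt_def]; omega) (by rw [Fin.lt_def]; omega) hks.symm
        (hm.trans hm'.symm)).symm)
  obtain ⟨j, hj⟩ := Q.word.surjective v
  have hju : ∀ m, Q.word.letter m = v → m = j := fun m hm =>
    le_antisymm (not_lt.1 (huniq j m hj hm)) (not_lt.1 (huniq m j hm hj))
  have hj1 := hpos j hj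
  obtain ⟨i, hi⟩ : ∃ i : Fin (n + d), (i : ℕ) + 1 = j :=
    ⟨⟨j - 1, by omega⟩, by simp only; omega⟩
  obtain ⟨l, hl⟩ : ∃ l : Fin (n + d), (j : ℕ) + 1 = l := ⟨⟨j + 1, by omega⟩, rfl⟩
  have h0 : ∀ a b : Fin (n + d), (a : ℕ) = 0 → Q.word.letter b = Q.word.letter a → b = a :=
    fun a b ha hab => Fin.ext (by
      rw [ha, ← Q.letter_eq_root_iff, hab, Q.letter_eq_root_iff, ha])
  refine ⟨i, j, l, hi, hl, by omega, ?_, hj, ?_⟩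
  · by_contra his
    -- Otherwise `i` would be a last occurrence, so that `v` would have occurred before `j`.
    have hlast : ∀ k, Q.word.letter k = Q.word.letter i → k ≤ i := by
      intro k hk
      by_contra hik
      rw [Fin.le_def] at hik
      have hkj : (k : ℕ) ≠ j := fun h => by
        rw [Fin.ext h] at hk
        exact Q.word.nondegenerate i j hi hk.symm
      rcases Q.left_of i j k (by rw [Fin.lt_def]; omega) (by rw [Fin.lt_def]; omega)
        hk.symm with h | h
      · exact Q.word.nondegenerate i j hi h.symm
      · rw [hj] at h
        exact (hcomp _ his).2 h
    obtain ⟨k, hk, hkj⟩ := Q.word.exists_lt_of_last hd h0 (by omega) hi hlast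
    exact hk.ne (hju k (hkj.trans hj))
  · -- The letter after `v` has occurred before, so it encloses `v`.
    obtain ⟨k, hk, hkl⟩ := Q.word.exists_lt_of_last hd h0 (by omega) hl
      (fun k hk => (hju k (hk.trans hj)).le)
    rw [Fin.lt_def] at hk
    have hkj : (k : ℕ) ≠ j := fun h => by
      rw [Fin.ext h] at hkl
      exact Q.word.nondegenerate j l hl hkl
    rcases Q.left_of k j l (by rw [Fin.lt_def]; omega) (by rw [Fin.lt_def]; omega) hkl with h | h
    · exact absurd (h.trans hkl) (Q.word.nondegenerate j l hl)
    · rw [hj, hkl] at h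
      by_contra hls
      exact (hcomp _ hls).2 h

section Coloring

variable {Q} {p q : Fin n → ℕ} {p' : ℕ}

/-- The root has exactly two children, the second letter of the word and the root of the rest of
the tree. -/
theorem exists_child_root (hd : d + 2 = n) (hn : 3 ≤ n) (hq : ∀ a, q a ≤ 2)
    (I : Q.tree.Coloring q) {i₁ : Fin (n + d)} (h₁ : (i₁ : ℕ) = 1) :
    ∃ c, Q.tree.edge Q.tree.root c ∧ c ≠ Q.word.letter i₁ ∧
      ∀ u, u ≠ Q.tree.root → u ≠ Q.word.letter i₁ → Q.tree.le c u := by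
  have key : ∀ u, u ≠ Q.tree.root → u ≠ Q.word.letter i₁ →
      ∃ b, Q.tree.edge Q.tree.root b ∧ b ≠ Q.word.letter i₁ ∧ Q.tree.le b u := by
    intro u hr hs
    rcases Q.tree.le_iff.1 (Q.tree.root_le u) with h | ⟨b, hb, hbu⟩
    · exact absurd h.symm hr
    · refine ⟨b, hb, ?_, hbu⟩
      rintro rfl
      exact hs (Q.letter_one_le hd h₁ hbu)
  obtain ⟨v, hv⟩ : ∃ v, v ∉ ({Q.tree.root, Q.word.letter i₁} : Finset (Fin n)) := by
    by_contra! h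
    have h2 := Finset.card_le_card (fun x _ => h x : Finset.univ ⊆ _)
    have h3 := h2.trans Finset.card_le_two
    rw [Finset.card_univ, Fintype.card_fin] at h3
    omega
  simp only [Finset.mem_insert, Finset.mem_singleton, not_or] at hv
  obtain ⟨c, hc, hcs, -⟩ := key v hv.1 hv.2
  refine ⟨c, hc, hcs, fun u hr hs => ?_⟩
  obtain ⟨b, hb, hbs, hbu⟩ := key u hr hs
  by_cases hbc : b = c
  · exact hbc ▸ hbu
  have h3 := I.card_le (a := Q.tree.root) (S := {b, c, Q.word.letter i₁}) (by
    simp only [Finset.mem_insert, Finset.mem_singleton]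
    rintro x (rfl | rfl | rfl)
    · exact hb
    · exact hc
    · exact Q.edge_root_letter_one hd h₁)
  rw [Finset.card_eq_three.2 ⟨b, c, _, hbc, hbs, hcs, rfl⟩] at h3
  have := hq Q.tree.root
  omega

/-- A vertex with at most one slot and with a proper descendant has a single child. -/
theorem exists_only_child {T : PTree n} (I : T.Coloring q) {a v : Fin n} (ha : q a ≤ 1)
    (hv : T.le a v) (hne : v ≠ a) :
    ∃ b, T.edge a b ∧ ∀ u, T.le a u → u ≠ a → T.le b u := by
  rcases T.le_iff.1 hv with h | ⟨b, hb, -⟩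
  · exact absurd h.symm hne
  refine ⟨b, hb, fun u hu hua => ?_⟩
  rcases T.le_iff.1 hu with h | ⟨b', hb', hbu⟩
  · exact absurd h.symm hua
  have h2 := I.card_le (a := a) (S := {b, b'}) (by
    simp only [Finset.mem_insert, Finset.mem_singleton]
    rintro x (rfl | rfl)
    · exact hb
    · exact hb')
  by_cases hbb : b = b'
  · exact hbb ▸ hbu
  · rw [Finset.card_pair hbb] at h2
    omega

end Coloring

end Quilt

/-! ### Colored quilts with vertices of total degree two -/

namespace Quilt

/-- The vertices other than the root and the second letter `s` form a chain in the tree, as each of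
them has positive `p` and so at most one slot. Each of them separates two occurrences of `s`, which
occurs at most three times, so there are only two. -/
theorem structure_of_coloring {n d : ℕ} {Q : Quilt n d} {p q : Fin n → ℕ} {p' : ℕ}
    (hd : d + 2 = n) (hn : 4 ≤ n)
    (hpq : ∀ a, p a + q a = 2) (ζ : Q.word.Coloring p p') (I : Q.tree.Coloring q)
    {i₁ : Fin (n + d)} (h₁ : (i₁ : ℕ) = 1) :
    n = 4 ∧ q (Q.word.letter i₁) = 0 ∧ ∃ c e : Fin n,
      Q.tree.edge Q.tree.root c ∧ Q.tree.edge c e ∧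
      ∀ m : Fin (n + d), ((m : ℕ) = 2 → Q.word.letter m = c) ∧
        ((m : ℕ) = 3 → Q.word.letter m = Q.word.letter i₁) ∧
        ((m : ℕ) = 4 → Q.word.letter m = e) ∧
        ((m : ℕ) = 5 → Q.word.letter m = Q.word.letter i₁) := by
  have hsroot := Q.edge_root_letter_one hd h₁
  obtain ⟨c, hc, hcs, hbelow⟩ :=
    exists_child_root hd (by omega) (fun a => by have := hpq a; omega) I h₁
  have hcr : c ≠ Q.tree.root := (Q.tree.ne_of_edge hc).symm
  have hcomp : ∀ u, u ≠ Q.word.letter i₁ → Q.tree.le u c ∨ Q.tree.le c u := by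
    intro u hu
    by_cases hur : u = Q.tree.root
    · exact Or.inl (hur ▸ Q.tree.root_le c)
    · exact Or.inr (hbelow u hur hu)
  obtain ⟨i, j, l, hij, hjl, hi0, his, hjc, hls⟩ := Q.enclosed_of_comparable hd h₁ hcr hcs hcomp
  have hpc := ζ.pos_of_enclosed hij hjl (his.trans hls.symm)
  rw [hjc] at hpc
  obtain ⟨v, hv⟩ : ∃ v, v ∉ ({Q.tree.root, Q.word.letter i₁, c} : Finset (Fin n)) := by
    by_contra! h
    have h2 := Finset.card_le_card (fun x _ => h x : Finset.univ ⊆ _)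
    have h3 := h2.trans Finset.card_le_three
    rw [Finset.card_univ, Fintype.card_fin] at h3
    omega
  simp only [Finset.mem_insert, Finset.mem_singleton, not_or] at hv
  obtain ⟨e, he, hbelow'⟩ := exists_only_child I (by have := hpq c; omega)
    (hbelow v hv.1 hv.2.1) hv.2.2
  have her : e ≠ Q.tree.root := fun h => Q.tree.not_edge_root c (h ▸ he)
  have hes : e ≠ Q.word.letter i₁ := fun h => hcr (Q.tree.parent_unique (h ▸ he) hsroot)
  have hcomp' : ∀ u, u ≠ Q.word.letter i₁ → Q.tree.le u e ∨ Q.tree.le e u := by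
    intro u hu
    by_cases huc : u = c
    · exact Or.inl (huc ▸ Q.tree.le_of_edge he)
    rcases hcomp u hu with h | h
    · exact Or.inl (Q.tree.le_trans h (Q.tree.le_of_edge he))
    · exact Or.inr (hbelow' u h huc)
  obtain ⟨i', j', l', hij', hjl', -, his', hje, hls'⟩ :=
    Q.enclosed_of_comparable hd h₁ her hes hcomp'
  have hpe := ζ.pos_of_enclosed hij' hjl' (his'.trans hls'.symm)
  rw [hje] at hpe
  have hjj := Q.lt_of_le (Q.tree.le_of_edge he) (Q.tree.ne_of_edge he) hjc hje
  rw [Fin.lt_def] at hjj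
  have hji : (j : ℕ) ≠ i' := fun h => hcs (by rw [← hjc, Fin.ext h, his'])
  have h3 := ζ.card_le (a := Q.word.letter i₁) (S := {i, l, l'}) (by
    simp only [Finset.mem_insert, Finset.mem_singleton]
    rintro x (rfl | rfl | rfl) <;> assumption)
  rw [Finset.card_eq_three.2 ⟨i, l, l', Fin.ne_of_lt (by rw [Fin.lt_def]; omega),
    Fin.ne_of_lt (by rw [Fin.lt_def]; omega), Fin.ne_of_lt (by rw [Fin.lt_def]; omega), rfl⟩] at h3
  have hps := hpq (Q.word.letter i₁)
  have hn4 : n = 4 := by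
    -- A fifth vertex would give a child `g` of `e`, and with it a fourth occurrence of `s`.
    by_contra hne
    obtain ⟨v, hv⟩ : ∃ v, v ∉ ({Q.tree.root, Q.word.letter i₁, c, e} : Finset (Fin n)) := by
      by_contra! h
      have h2 := Finset.card_le_card (fun x _ => h x : Finset.univ ⊆ _)
      have h3 := h2.trans Finset.card_le_four
      rw [Finset.card_univ, Fintype.card_fin] at h3
      omega
    simp only [Finset.mem_insert, Finset.mem_singleton, not_or] at hv
    obtain ⟨g, hg, hbelow''⟩ := exists_only_child I (by have := hpq e; omega)
      (hbelow' v (hbelow v hv.1 hv.2.1) hv.2.2.1) hv.2.2.2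
    have hgr : g ≠ Q.tree.root := fun h => Q.tree.not_edge_root e (h ▸ hg)
    have hgs : g ≠ Q.word.letter i₁ := fun h => her (Q.tree.parent_unique (h ▸ hg) hsroot)
    have hcomp'' : ∀ u, u ≠ Q.word.letter i₁ → Q.tree.le u g ∨ Q.tree.le g u := by
      intro u hu
      by_cases hue : u = e
      · exact Or.inl (hue ▸ Q.tree.le_of_edge hg)
      rcases hcomp' u hu with h | h
      · exact Or.inl (Q.tree.le_trans h (Q.tree.le_of_edge hg))
      · exact Or.inr (hbelow'' u h hue)
    obtain ⟨i'', j'', l'', hij'', hjl'', -, his'', hjg, hls''⟩ :=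
      Q.enclosed_of_comparable hd h₁ hgr hgs hcomp''
    have hjj' := Q.lt_of_le (Q.tree.le_of_edge hg) (Q.tree.ne_of_edge hg) hje hjg
    rw [Fin.lt_def] at hjj'
    have h4 := ζ.card_le (a := Q.word.letter i₁) (S := {i, l, l', l''}) (by
      simp only [Finset.mem_insert, Finset.mem_singleton]
      rintro x (rfl | rfl | rfl | rfl) <;> assumption)
    have h4' : ({i, l, l', l''} : Finset (Fin (n + d))).card = 4 := by
      rw [Finset.card_insert_of_notMem, Finset.card_eq_three.2 ⟨l, l', l'', ?_, ?_, ?_, rfl⟩]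
      · exact Fin.ne_of_lt (by rw [Fin.lt_def]; omega)
      · exact Fin.ne_of_lt (by rw [Fin.lt_def]; omega)
      · exact Fin.ne_of_lt (by rw [Fin.lt_def]; omega)
      · simp only [Finset.mem_insert, Finset.mem_singleton, Fin.ext_iff]
        omega
    omega
  refine ⟨hn4, by omega, c, e, hc, he, fun m => ⟨fun hm => ?_, fun hm => ?_, fun hm => ?_,
    fun hm => ?_⟩⟩
  · rw [← hjc]; exact congrArg _ (Fin.ext (by omega))
  · rw [← hls]; exact congrArg _ (Fin.ext (by omega))
  · rw [← hje]; exact congrArg _ (Fin.ext (by omega))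
  · rw [← hls']; exact congrArg _ (Fin.ext (by omega))

theorem ext_data {n d : ℕ} {Q Q' : Quilt n d} (hw : Q.word.letter = Q'.word.letter)
    (he : Q.tree.edge = Q'.tree.edge) (hl : Q.tree.left = Q'.tree.left) : Q = Q' := by
  obtain ⟨⟨_, _, _, _⟩, ⟨_, _, _, _, _, _, _, _, _, _⟩, _, _⟩ := Q
  obtain ⟨⟨_, _, _, _⟩, ⟨_, _, _, _, _, _, _, _, _, _⟩, _, _⟩ := Q'
  subst hw he hl
  rfl

theorem eq_quilt1324 {Q : Quilt 4 2} (ho : Q.word.Ordered) {c e : Fin 4}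
    (hc : Q.tree.edge Q.tree.root c) (he : Q.tree.edge c e)
    (hm : ∀ m : Fin (4 + 2), ((m : ℕ) = 2 → Q.word.letter m = c) ∧
        ((m : ℕ) = 3 → Q.word.letter m = Q.word.letter 1) ∧
        ((m : ℕ) = 4 → Q.word.letter m = e) ∧
        ((m : ℕ) = 5 → Q.word.letter m = Q.word.letter 1)) : Q = quilt1324 := by
  have w0 : Q.word.letter 0 = Q.tree.root := Q.letter_eq_root_iff.2 rfl
  have w2 : Q.word.letter 2 = c := (hm 2).1 rfl
  have w3 : Q.word.letter 3 = Q.word.letter 1 := (hm 3).2.1 rfl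
  have w4 : Q.word.letter 4 = e := (hm 4).2.2.1 rfl
  have w5 : Q.word.letter 5 = Q.word.letter 1 := (hm 5).2.2.2 rfl
  have hs := Q.edge_root_letter_one rfl (i₁ := 1) rfl
  have hrs := Q.tree.ne_of_edge hs
  have hrc := Q.tree.ne_of_edge hc
  have hce := Q.tree.ne_of_edge he
  have hre : Q.tree.root ≠ e := fun h => Q.tree.not_edge_root c (h ▸ he)
  have hsc : Q.word.letter 1 ≠ c := by
    rw [← w2]; exact Q.word.nondegenerate 1 2 rfl
  have hse : Q.word.letter 1 ≠ e := by
    rw [← w4, ← w3]; exact Q.word.nondegenerate 3 4 rfl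
  have l1 := Q.left_letter_one rfl (i₁ := 1) rfl hrc.symm hsc.symm
  have l2 := Q.left_letter_one rfl (i₁ := 1) rfl hre.symm hse.symm
  -- The order of first occurrence is that of the letters root, `s`, `c`, `e`.
  have o1 : Q.tree.root < Q.word.letter 1 := by
    by_contra h
    obtain ⟨i, hi, hlt⟩ := ho _ _ (lt_of_le_of_ne (not_lt.1 h) hrs.symm)
    exact absurd (hlt 0 w0) (by simp)
  have o2 : Q.word.letter 1 < c := by
    by_contra h
    obtain ⟨i, hi, hlt⟩ := ho _ _ (lt_of_le_of_ne (not_lt.1 h) hsc.symm)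
    have h0 : ∀ i : Fin (4 + 2), i < 1 → i = 0 := by decide
    rw [h0 i (hlt 1 rfl)] at hi
    exact hrc (w0.symm.trans hi)
  have o3 : c < e := by
    by_contra h
    obtain ⟨i, hi, hlt⟩ := ho _ _ (lt_of_le_of_ne (not_lt.1 h) hce.symm)
    have h0 : ∀ i : Fin (4 + 2), i < 2 → i = 0 ∨ i = 1 := by decide
    rcases h0 i (hlt 2 w2) with rfl | rfl
    · exact hre (w0.symm.trans hi)
    · exact hse hi
  have er : Q.tree.root = 0 := by omega
  have es : Q.word.letter 1 = 1 := by omega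
  have ec : c = 2 := by omega
  have ee : e = 3 := by omega
  subst ec ee
  rw [er] at hc hs w0
  rw [es] at hs l1 l2 w3 w5
  refine ext_data ?_ ?_ ?_
  · funext i
    fin_cases i
    exacts [w0, es, w2, w3, w4, w5]
  · have key : ∀ u v, Q.tree.edge u v = true ↔
        (u = 0 ∧ v = 2) ∨ (u = 0 ∧ v = 1) ∨ (u = 2 ∧ v = 3) := by
      intro u v
      constructor
      · intro h
        fin_cases v
        · exact absurd (er ▸ h) (Q.tree.not_edge_root u)
        · exact Or.inr (Or.inl ⟨Q.tree.parent_unique h hs, rfl⟩)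
        · exact Or.inl ⟨Q.tree.parent_unique h hc, rfl⟩
        · exact Or.inr (Or.inr ⟨Q.tree.parent_unique h he, rfl⟩)
      · rintro (⟨rfl, rfl⟩ | ⟨rfl, rfl⟩ | ⟨rfl, rfl⟩)
        exacts [hc, hs, he]
    funext u v
    rw [Bool.eq_iff_iff, key]
    simp [quilt1324, PTree.ofDepthTwo]
  · have hle0 : ∀ v, Q.tree.le 0 v := fun v => er ▸ Q.tree.root_le v
    have hle := Q.tree.le_of_edge he
    have key : ∀ u v, Q.tree.left u v = true ↔ (u = 2 ∨ u = 3) ∧ v = 1 := by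
      intro u v
      constructor
      · intro h
        have hu : u ≠ 0 := fun h0 => (Q.tree.not_le_of_left h).1 (h0 ▸ hle0 v)
        have hv : v ≠ 0 := fun h0 => (Q.tree.not_le_of_left h).2 (h0 ▸ hle0 u)
        have huv : u ≠ v := fun h0 => (Q.tree.not_le_of_left h).1 (h0 ▸ Q.tree.le_refl u)
        have h12 : ¬ (u = 1 ∧ v = 2) := fun h0 =>
          Q.tree.not_left_of_left l1 (h0.1 ▸ h0.2 ▸ h)
        have h13 : ¬ (u = 1 ∧ v = 3) := fun h0 =>
          Q.tree.not_left_of_left l2 (h0.1 ▸ h0.2 ▸ h)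
        have h23 : ¬ (u = 2 ∧ v = 3) := fun h0 =>
          (Q.tree.not_le_of_left h).1 (h0.1 ▸ h0.2 ▸ hle)
        have h32 : ¬ (u = 3 ∧ v = 2) := fun h0 =>
          (Q.tree.not_le_of_left h).2 (h0.1 ▸ h0.2 ▸ hle)
        omega
      · rintro ⟨rfl | rfl, rfl⟩
        exacts [l1, l2]
    funext u v
    rw [Bool.eq_iff_iff, key]
    simp [quilt1324, PTree.ofDepthTwo]

end Quilt

/-! ### The operations on elements of shifted total degree one -/

section Operations

variable {k : Type u} [Field k] {C : Type v} [Category.{t} C] {A : C ⥤ NUAlg.{u, w} k}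

theorem hasDegree_mHat : (mHat A).HasDegree 1 := by
  intro p q h
  have : (p, q) = (0, 2) := by
    by_contra hne
    exact h (DirectSum.of_eq_of_ne _ _ _ hne)
  rw [Prod.mk.injEq] at this
  rw [this.1, this.2]
  norm_num

theorem Quilt.act_eq_zero {n d : ℕ} (Q : Quilt n d) {p q : Fin n → ℕ}
    (f : ∀ a, Cochain A (p a) (q a))
    (h : ∀ (_ : Q.word.Coloring p (∑ a, p a - d)) (_ : Q.tree.Coloring q), False) :
    Q.act f = 0 :=
  Finset.sum_eq_zero fun ζ _ => Finset.sum_eq_zero fun I _ => (h ζ I).elim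

/-- A quilt acts by zero if it has no colorings for the bidegrees that occur in its arguments. -/
theorem Quilt.hat_eq_zero {n d : ℕ} (Q : Quilt n d) {f : Fin n → Tot A}
    (hf : ∀ a, (f a).HasDegree 1)
    (h : ∀ p q : Fin n → ℕ, (∀ a, f a (p a, q a) ≠ 0) → (∀ a, p a + q a = 2) →
      ∀ (_ : Q.word.Coloring p (∑ a, p a - d)) (_ : Q.tree.Coloring q), False) :
    Q.hat f = 0 := by
  refine Finset.sum_eq_zero fun b hb => ?_
  have hb : ∀ a, f a (b a) ≠ 0 := fun a => by
    classical
    have := Fintype.mem_piFinset.1 hb a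
    exact DFinsupp.mem_support_iff.1 this
  rw [Q.act_eq_zero _ (h _ _ hb fun a => by
    have := hf a _ _ (hb a)
    omega)]
  exact map_zero _

theorem hatPZero_eq_zero {n : ℕ} (hn : 5 ≤ n) {f : Fin n → Tot A} (hf : ∀ a, (f a).HasDegree 1) :
    hatPZero n f = 0 := by
  unfold hatPZero
  rw [Finset.sum_eq_zero, smul_zero]
  intro Q _
  refine Q.hat_eq_zero hf fun p q _ hpq ζ I => ?_
  have := (Quilt.structure_of_coloring (by omega) (by omega) hpq ζ I
    (i₁ := ⟨1, by omega⟩) rfl).1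
  omega

theorem hatPZero_four {f : Fin 4 → Tot A} (hf : ∀ a, (f a).HasDegree 1) :
    hatPZero 4 f = - quilt1324.hat f := by
  classical
  have hord : quilt1324.word.Ordered := by
    show ∀ a b : Fin 4, a < b → ∃ i : Fin (4 + 2), ![0, 1, 2, 1, 3, 1] i = a ∧
      ∀ j : Fin (4 + 2), ![0, 1, 2, 1, 3, 1] j = b → i < j
    decide
  unfold hatPZero
  rw [Finset.sum_eq_single (quilt1324 : Quilt 4 (4 - 2))]
  · norm_num
  · intro Q hQ hne
    refine Q.hat_eq_zero hf fun p q _ hpq ζ I => hne ?_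
    obtain ⟨-, -, c, e, hc, he, hm⟩ := Quilt.structure_of_coloring rfl le_rfl hpq ζ I
      (i₁ := 1) rfl
    exact Quilt.eq_quilt1324 (Finset.mem_filter.1 hQ).2 hc he hm
  · intro h
    refine absurd ?_ h
    rw [Finset.mem_filter]
    exact ⟨Finset.mem_univ _, hord⟩

/-- The vertex `1`, whose letter occurs three times in the word, only admits components of bidegree
`(2, 0)`, which vanish in the asimplicial subcomplex. -/
theorem quilt1324_hat_eq_zero {f : Fin 4 → Tot A} (hf : ∀ a, (f a).HasDegree 1)
    (h : f 1 ∈ asimplicial A) : quilt1324.hat f = 0 := by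
  refine Quilt.hat_eq_zero _ hf fun p q hne hpq ζ I => hne 1 ?_
  have hq : q 1 = 0 := (Quilt.structure_of_coloring rfl le_rfl hpq ζ I (i₁ := 1) rfl).2.1
  rw [hq]
  exact h (p 1)

theorem hatP_eq_zero {f : Tot A} (hf : f.HasDegree 1) {n : ℕ} (hn : 5 ≤ n) :
    hatP n (fun _ => f) = 0 := by
  unfold hatP
  rw [hatPZero_eq_zero hn fun _ => hf, hatPZero_eq_zero (by omega) (Fin.cases hasDegree_mHat
    fun _ => hf), add_zero]

theorem hatP_four {f : Tot A} (hf : f.HasDegree 1) :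
    hatP 4 (fun _ => f) = - quilt1324.hat (fun _ => f) := by
  unfold hatP
  rw [hatPZero_four fun _ => hf, hatPZero_eq_zero le_rfl (Fin.cases hasDegree_mHat
    fun _ => hf), add_zero]

theorem maurerCartan_iff {f : Tot A} (hf : f.HasDegree 1) : MaurerCartan f ↔
    delta f + hatP 2 (fun _ => f) + hatP 3 (fun _ => f) + hatP 4 (fun _ => f) = 0 := by
  have hfin : {n : ℕ | 2 ≤ n ∧ hatP n (fun _ => f) ≠ 0}.Finite :=
    (Set.finite_Iio 5).subset fun n hn => by
      by_contra h
      exact hn.2 (hatP_eq_zero hf (not_lt.1 h))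
  have hsum : ∑ᶠ (n : ℕ) (_ : 2 ≤ n), hatP n (fun _ => f) =
      ∑ n ∈ Finset.Ico 2 5, hatP n (fun _ => f) := by
    refine finsum_mem_eq_sum_of_inter_support_eq (s := {n : ℕ | 2 ≤ n}) _ ?_
    ext n
    simp only [Set.mem_inter_iff, Set.mem_ofPred_eq, Function.mem_support, Finset.coe_Ico,
      Set.mem_Ico]
    refine ⟨fun h => ⟨⟨h.1, ?_⟩, h.2⟩, fun h => ⟨h.1.1, h.2⟩⟩
    by_contra h5
    exact h.2 (hatP_eq_zero hf (not_lt.1 h5))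
  rw [MaurerCartan, hsum, and_iff_right hfin]
  simp [Finset.sum_Ico_succ_top, add_assoc]

end Operations

end HochschildQuilt

theorem mainTheorem8 {k : Type u} [Field k] {C : Type v} [Category.{t} C]
    (A : C ⥤ NUAlg.{u, w} k) (f : Tot A) (hf : f.HasDegree 1) :
    (f ∈ asimplicial A →
      (∀ n, 4 ≤ n → hatP n (fun _ => f) = 0) ∧
      (MaurerCartan f ↔
        delta f + hatP 2 (fun _ => f) + hatP 3 (fun _ => f) = 0)) ∧
    (∀ n, 5 ≤ n → hatP n (fun _ => f) = 0) ∧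
    (MaurerCartan f ↔
      delta f + hatP 2 (fun _ => f) + hatP 3 (fun _ => f) + hatP 4 (fun _ => f) = 0) ∧
    hatP 4 (fun _ => f) = - quilt1324.hat (fun _ => f) := by
  have hP4 := hatP_four hf
  refine ⟨fun ha => ?_, fun n hn => hatP_eq_zero hf hn, maurerCartan_iff hf, hP4⟩
  have h4 : hatP 4 (fun _ => f) = 0 := by
    rw [hP4, quilt1324_hat_eq_zero (fun _ => hf) ha, neg_zero]
  refine ⟨fun n hn => ?_, by rw [maurerCartan_iff hf, h4, add_zero]⟩
  rcases hn.eq_or_lt with rfl | hn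
  · exact h4
  · exact hatP_eq_zero hf hn
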